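/- **Categories.** A *$*$-category* is a small category $\mathbf A$ with an involution $*:\mathbf A\to\mathbf A^{op}$ that fixes the objects; morphisms of $*$-categories are functors preserving the involutions. A *$\mathbb C$-linear $*$-category* is a $*$-category enriched over $\mathbb C$-vector spaces whose involution is anti-linear; its morphisms are the morphisms of $*$-categories that are $\mathbb C$-linear on $\mathrm{Hom}$-spaces. A *representation* of a $\mathbb C$-linear $*$-category $\mathbf A$ in a (possibly non-unital, possibly zero) $C^*$-algebra $B$ is a map $\rho:\mathrm{Mor}(\mathbf A)\to B$ that is linear on each $\mathrm{Hom}$-space, with $\rho(f\circ g)=\rho(f)\rho(g)$ for composable $f,g$, and with $\rho(f^*)=\rho(f)^*$; the *maximal norm* is $\|f\|_{max}:=\sup_\rho\|\rho(f)\|\in[0,\infty]$. A *$C^*$-category* is a $\mathbb C$-linear $*$-category in which every morphism has finite maximal norm and every $\mathrm{Hom}$-space is a Banach space for $\|-\|_{max}$. Denote by $\mathbf{{}^*Cat}_1$, $\mathbf{{}^*_{\mathbb C}Cat}_1$, $\mathbf{C^*Cat}_1$ the categories of $*$-categories, $\mathbb C$-linear $*$-categories, and $C^*$-categories (the last being a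 full subcategory of the second). A morphism $u$ is *unitary* if $u^*u=\mathrm{id}$ and $uu^*=\mathrm{id}$. A *marking* on $\mathbf A$ is a set of unitary morphisms that contains the identities and is closed under composition and the involution; morphisms of marked objects must preserve the marked morphisms. This gives the marked versions $\mathbf{{}^*Cat}_1^+$, $\mathbf{{}^*_{\mathbb C}Cat}_1^+$, $\mathbf{C^*Cat}_1^+$. **Model structures.** Let $\mathcal C$ be one of these six categories. A morphism $f:\mathbf A\to\mathbf B$ of $\mathcal C$ is a *weak equivalence* if there is a morphism $g:\mathbf B\to\mathbf A$ of $\mathcal C$ such that $g\circ f$ and $f\circ g$ are isomorphic to the identity functors by natural transformations consisting of unitary (in the marked cases: marked) morphisms; a *cofibration* if it is injective on objects; a *fibration* if it has the right lifting property with respect to all morphisms that are both cofibrations and weak equivalences. For a group $G$, let $BG$ be the category with one object whose endomorphism monoid is $G$. A morphism of $\mathrm{Fun}(BG,\mathcal C)$ is a *projective weak equivalence* (*projective fibration*) if its underlying morphism in $\mathcal C$ is a weak equivalence (fibration), and a *projective cofibration* if it has the left lifting property with respect to all morphisms that are both projective fibrations and projective weak equivalences. An object is *projectively cofibrant* if the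 morphism to it from the initial object is a projective cofibration. **The functor $-\sharp\tilde G$.** For $\mathbf A$ in $\mathcal C$ and a groupoid $\mathbb G$ define $\mathbf A\sharp\mathbb G$ as follows. * For $*$-categories, $\mathbf A\sharp\mathbb G:=\mathbf A\times\mathbb G$ with $(f,\phi)^*:=(f^*,\phi^{-1})$. * For $\mathbb C$-linear $*$-categories, $\mathbf A\sharp\mathbb G:=\mathbf A\otimes\mathbb G$ has the objects of $\mathbf A\times\mathbb G$ and $\mathrm{Hom}((a,g),(a',g')):=\bigoplus_{\phi\in\mathrm{Hom}_{\mathbb G}(g,g')}\mathrm{Hom}_{\mathbf A}(a,a')$; writing $(f,\phi)$ for $f$ in the summand $\phi$, composition and involution are the bilinear, respectively anti-linear, extensions of $(f',\phi')\circ(f,\phi)=(f'\circ f,\phi'\circ\phi)$ and $(f,\phi)^*=(f^*,\phi^{-1})$. * For $C^*$-categories, $\mathbf A\sharp\mathbb G:=\mathbf A\otimes_{max}\mathbb G$ is the completion of $\mathbf A\otimes\mathbb G$ (whose morphisms have finite maximal norm): the objects are kept and each $\mathrm{Hom}$-space is replaced by its separated completion with respect to $\|-\|_{max}$. In the marked cases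 the marked morphisms of $\mathbf A\sharp\mathbb G$ are the (images of the) morphisms $(f,\phi)$ with $f$ marked in $\mathbf A$ and $\phi$ arbitrary. The construction is functorial in $\mathbf A$ and $\mathbb G$, and the unique functor $\mathbb G\to*$ to the one-point groupoid induces the projection $\mathbf A\sharp\mathbb G\to\mathbf A\sharp *\cong\mathbf A$, $(a,g)\mapsto a$, $(f,\phi)\mapsto f$. Let $\tilde G$ be the groupoid with object set $G$ and exactly one morphism between any two objects, with $G$ acting by left multiplication on objects. For $\mathbf D$ in $\mathrm{Fun}(BG,\mathcal C)$ let $L(\mathbf D):=\mathbf D\sharp\tilde G$ with the diagonal $G$-action. This defines a functor $L:\mathrm{Fun}(BG,\mathcal C)\to\mathrm{Fun}(BG,\mathcal C)$, with the natural transformation $\varepsilon:L\to\mathrm{id}$ induced by $\tilde G\to *$. **Lemma.** Let $\mathcal C$ be one of $$\mathbf{{}^*Cat}_1,\quad \mathbf{{}^*_{\mathbb C}Cat}_1,\quad \mathbf{C^*Cat}_1,\quad \mathbf{{}^*Cat}_1^+,\quad \mathbf{{}^*_{\mathbb C}Cat}_1^+,\quad \mathbf{C^*Cat}_1^+,$$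 and let $G$ be a group. Then $L=-\sharp\tilde G$ together with $\varepsilon:L\to\mathrm{id}$ is a cofibrant replacement functor for the projective model structure on $\mathrm{Fun}(BG,\mathcal C)$: for every $\mathbf D$ in $\mathrm{Fun}(BG,\mathcal C)$ the object $L(\mathbf D)$ is projectively cofibrant and $\varepsilon_{\mathbf D}:L(\mathbf D)\to\mathbf D$ is a projective weak equivalence. -/

import Mathlib

open CategoryTheory HomotopicalAlgebra
open scoped ENNReal

universe v u v₁ u₁

namespace StarCats

/-! ### Star-categories -/

/-- A `*`-category: a category with an involution `A ⥤ Aᵒᵖ` which is the identity on objects.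
(That the involution preserves identities is automatic, see `StarCategory.invol_id`.) -/
class StarCategory (A : Type u) [Category.{v} A] where
  /-- the involution `f ↦ f^*` -/
  invol {X Y : A} : (X ⟶ Y) → (Y ⟶ X)
  invol_invol {X Y : A} (f : X ⟶ Y) : invol (invol f) = f
  invol_comp {X Y Z : A} (f : X ⟶ Y) (g : Y ⟶ Z) : invol (f ≫ g) = invol g ≫ invol f


attribute [simp] StarCategory.invol_invol StarCategory.invol_comp

open StarCategory

@[simp]
theorem StarCategory.invol_id {A : Type u} [Category.{v} A] [StarCategory A] (X : A) :
    invol (𝟙 X) = 𝟙 X := by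
  have h : invol (invol (𝟙 X) ≫ 𝟙 X) = invol (𝟙 X) ≫ 𝟙 X := by
    rw [invol_comp, invol_invol, Category.comp_id]
  rwa [Category.comp_id, invol_invol, eq_comm] at h

/-- A morphism `u` is unitary if `u^* u = id` and `u u^* = id`. -/
def IsUnitary {A : Type u} [Category.{v} A] [StarCategory A] {X Y : A} (f : X ⟶ Y) : Prop :=
  f ≫ invol f = 𝟙 X ∧ invol f ≫ f = 𝟙 Y

/-- A morphism of `*`-categories: a functor which preserves the involutions. -/
structure StarFunctor (A : Type u) [Category.{v} A] [StarCategory A]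
    (B : Type u₁) [Category.{v₁} B] [StarCategory B] extends A ⥤ B where
  map_invol {X Y : A} (f : X ⟶ Y) : map (invol f) = invol (map f)

theorem StarFunctor.ext_functor {A : Type u} [Category.{v} A] [StarCategory A]
    {B : Type u₁} [Category.{v₁} B] [StarCategory B] {F G : StarFunctor A B}
    (h : F.toFunctor = G.toFunctor) : F = G := by
  cases F; cases G; cases h; rfl

/-- A `ℂ`-linear `*`-category: a `*`-category enriched over `ℂ`-vector spaces whose involution
is anti-linear. -/
class LinearStarCategory (A : Type u) [Category.{v} A] [Preadditive A] [Linear ℂ A]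
    extends StarCategory A where
  invol_add {X Y : A} (f g : X ⟶ Y) : invol (f + g) = invol f + invol g
  invol_smul {X Y : A} (c : ℂ) (f : X ⟶ Y) : invol (c • f) = (starRingEnd ℂ c) • invol f

theorem LinearStarCategory.invol_zero {A : Type u} [Category.{v} A] [Preadditive A] [Linear ℂ A]
    [LinearStarCategory A] (X Y : A) : invol (0 : X ⟶ Y) = 0 := by
  simpa using LinearStarCategory.invol_smul (0 : ℂ) (0 : X ⟶ Y)

/-- A morphism of `ℂ`-linear `*`-categories. -/
structure LinStarFunctor (A : Type u) [Category.{v} A] [Preadditive A] [Linear ℂ A]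
    [LinearStarCategory A] (B : Type u₁) [Category.{v₁} B] [Preadditive B] [Linear ℂ B]
    [LinearStarCategory B] extends StarFunctor A B where
  map_add {X Y : A} (f g : X ⟶ Y) : map (f + g) = map f + map g
  map_smul {X Y : A} (c : ℂ) (f : X ⟶ Y) : map (c • f) = c • map f

theorem LinStarFunctor.ext_functor {A : Type u} [Category.{v} A] [Preadditive A] [Linear ℂ A]
    [LinearStarCategory A] {B : Type u₁} [Category.{v₁} B] [Preadditive B] [Linear ℂ B]
    [LinearStarCategory B] {F G : LinStarFunctor A B}
    (h : F.toFunctor = G.toFunctor) : F = G := by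
  obtain ⟨F, _, _⟩ := F
  obtain ⟨G, _, _⟩ := G
  have : F = G := StarFunctor.ext_functor h
  subst this; rfl

theorem LinStarFunctor.map_zero {A : Type u} [Category.{v} A] [Preadditive A] [Linear ℂ A]
    [LinearStarCategory A] {B : Type u₁} [Category.{v₁} B] [Preadditive B] [Linear ℂ B]
    [LinearStarCategory B] (F : LinStarFunctor A B) (X Y : A) : F.map (0 : X ⟶ Y) = 0 := by
  simpa using F.map_smul (0 : ℂ) (0 : X ⟶ Y)

/-- The category `*Cat₁` of `*`-categories: objects. -/
structure StarCat : Type (max (u + 1) (v + 1)) where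
  carrier : Type u
  [cat : Category.{v} carrier]
  [star : StarCategory carrier]

attribute [instance] StarCat.cat StarCat.star

instance : CoeSort StarCat.{v, u} (Type u) := ⟨StarCat.carrier⟩

instance : Category.{max v u} StarCat.{v, u} where
  Hom A B := StarFunctor A B
  id A := { 𝟭 A with map_invol := fun _ => rfl }
  comp F G :=
    { F.toFunctor ⋙ G.toFunctor with
      map_invol := fun f => (congrArg G.map (F.map_invol f)).trans (G.map_invol _) }

/-- The category of `ℂ`-linear `*`-categories: objects. -/
structure LinStarCat : Type (max (u + 1) (v + 1)) where
  carrier : Type u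
  [cat : Category.{v} carrier]
  [preadditive : Preadditive carrier]
  [linear : Linear ℂ carrier]
  [star : LinearStarCategory carrier]

attribute [instance] LinStarCat.cat LinStarCat.preadditive LinStarCat.linear LinStarCat.star

instance : CoeSort LinStarCat.{v, u} (Type u) := ⟨LinStarCat.carrier⟩

instance : Category.{max v u} LinStarCat.{v, u} where
  Hom A B := LinStarFunctor A B
  id A :=
    { 𝟭 A with
      map_invol := fun _ => rfl
      map_add := fun _ _ => rfl
      map_smul := fun _ _ => rfl }
  comp F G :=
    { F.toFunctor ⋙ G.toFunctor with
      map_invol := fun f => (congrArg G.map (F.map_invol f)).trans (G.map_invol _)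
      map_add := fun f g => (congrArg G.map (F.map_add f g)).trans (G.map_add _ _)
      map_smul := fun c f => (congrArg G.map (F.map_smul c f)).trans (G.map_smul _ _) }

/-- Forget the linear structure. -/
def LinStarCat.forget : LinStarCat.{v, u} ⥤ StarCat.{v, u} where
  obj A := { carrier := A }
  map F := F.toStarFunctor

/-! ### The maximal norm, pre-`C^*`-categories and `C^*`-categories -/

section Norm

variable (A : Type u) [Category.{v} A] [Preadditive A] [Linear ℂ A] [LinearStarCategory A]

/-- A representation of a `ℂ`-linear `*`-category in a (possibly non-unital) `C^*`-algebra. -/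
structure StarRep (B : Type (max u v)) [NonUnitalCStarAlgebra B] where
  toFun {X Y : A} : (X ⟶ Y) → B
  map_add {X Y : A} (f g : X ⟶ Y) : toFun (f + g) = toFun f + toFun g
  map_smul {X Y : A} (c : ℂ) (f : X ⟶ Y) : toFun (c • f) = c • toFun f
  map_comp {X Y Z : A} (f : X ⟶ Y) (g : Y ⟶ Z) : toFun (f ≫ g) = toFun g * toFun f
  map_invol {X Y : A} (f : X ⟶ Y) : toFun (invol f) = star (toFun f)

variable {A}

/-- The maximal norm of a morphism: the supremum of `‖ρ f‖` over all representations `ρ` in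
`C^*`-algebras. (Every representation generates a `C^*`-algebra which is small enough to be
isomorphic to one in the universe of the morphisms of `A`.) -/
noncomputable def maxNorm {X Y : A} (f : X ⟶ Y) : ℝ≥0∞ :=
  ⨆ (B : Type (max u v)) (_ : NonUnitalCStarAlgebra B) (ρ : StarRep A B), ‖ρ.toFun f‖ₑ

variable (A)

/-- A pre-`C^*`-category: every morphism has finite maximal norm. -/
class IsPreCStar : Prop where
  maxNorm_ne_top {X Y : A} (f : X ⟶ Y) : maxNorm f ≠ ∞

/-- A `C^*`-category: a pre-`C^*`-category whose morphism spaces are Banach spaces with respect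
to the maximal norm, i.e. the maximal norm is definite and every Cauchy sequence converges. -/
class IsCStar : Prop extends IsPreCStar A where
  eq_zero {X Y : A} (f : X ⟶ Y) : maxNorm f = 0 → f = 0
  complete {X Y : A} (s : ℕ → (X ⟶ Y)) :
    (∀ ε : ℝ≥0∞, 0 < ε → ∃ N, ∀ m ≥ N, ∀ n ≥ N, maxNorm (s m - s n) < ε) →
      ∃ f : X ⟶ Y, Filter.Tendsto (fun n => maxNorm (s n - f)) Filter.atTop (nhds 0)

end Norm

/-- The property of a `ℂ`-linear `*`-category of being a `C^*`-category. -/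
def LinStarCat.isCStar : ObjectProperty LinStarCat.{v, u} := fun A => IsCStar A

/-- The category of `C^*`-categories, a full subcategory of the `ℂ`-linear `*`-categories. -/
abbrev CStarCat : Type (max (u + 1) (v + 1)) := LinStarCat.isCStar.{v, u}.FullSubcategory

instance (A : CStarCat.{v, u}) : IsCStar A.obj := A.property

/-- Forget everything but the `*`-category. -/
def CStarCat.forget : CStarCat.{v, u} ⥤ StarCat.{v, u} :=
  ObjectProperty.ι _ ⋙ LinStarCat.forget

/-! ### Markings -/

/-- A marking on a `*`-category: a set of unitary morphisms which contains the identities and is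
closed under composition and the involution. -/
structure Marking (A : Type u) [Category.{v} A] [StarCategory A] where
  marked {X Y : A} : (X ⟶ Y) → Prop
  isUnitary {X Y : A} {f : X ⟶ Y} : marked f → IsUnitary f
  id_mem (X : A) : marked (𝟙 X)
  comp_mem {X Y Z : A} {f : X ⟶ Y} {g : Y ⟶ Z} : marked f → marked g → marked (f ≫ g)
  invol_mem {X Y : A} {f : X ⟶ Y} : marked f → marked (invol f)

/-- Marked objects of a category `C` of `*`-categories (given by its functor to `*Cat₁` which
forgets all additional structure): an object with a marking. -/
structure Marked {C : Type u₁} [Category.{v₁} C] (U : C ⥤ StarCat.{v, u}) where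
  obj : C
  marking : Marking (U.obj obj)

namespace Marked

variable {C : Type u₁} [Category.{v₁} C] {U : C ⥤ StarCat.{v, u}}

/-- Morphisms of marked objects are the morphisms which preserve marked morphisms. -/
@[ext]
structure Hom (A B : Marked U) where
  hom : A.obj ⟶ B.obj
  map_marked {X Y : U.obj A.obj} {f : X ⟶ Y} :
    A.marking.marked f → B.marking.marked ((U.map hom).map f)

instance : Category (Marked U) where
  Hom A B := Hom A B
  id A := ⟨𝟙 A.obj, fun {X Y f} hf => by rw [U.map_id]; exact hf⟩
  comp F G := ⟨F.hom ≫ G.hom, fun {X Y f} hf => by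
    rw [U.map_comp]; exact G.map_marked (F.map_marked hf)⟩
  id_comp F := Hom.ext (Category.id_comp F.hom)
  comp_id F := Hom.ext (Category.comp_id F.hom)
  assoc F G H := Hom.ext (Category.assoc F.hom G.hom H.hom)

@[ext]
theorem hom_ext {A B : Marked U} {F G : A ⟶ B} (h : F.hom = G.hom) : F = G := Hom.ext h

@[simp] theorem id_hom (A : Marked U) : Hom.hom (𝟙 A) = 𝟙 A.obj := rfl

@[simp] theorem comp_hom {A B D : Marked U} (F : A ⟶ B) (G : B ⟶ D) :
    Hom.hom (F ≫ G) = F.hom ≫ G.hom := rfl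

variable (U) in
/-- Forget the marking and all structure except for the `*`-category. -/
def forget : Marked U ⥤ StarCat.{v, u} where
  obj A := U.obj A.obj
  map F := U.map F.hom
  map_id A := U.map_id A.obj
  map_comp F G := U.map_comp F.hom G.hom

end Marked

/-- The category `*Cat₁⁺` of marked `*`-categories. -/
abbrev MarkedStarCat : Type (max (u + 1) (v + 1)) := Marked (𝟭 StarCat.{v, u})

/-- The category of marked `ℂ`-linear `*`-categories. -/
abbrev MarkedLinStarCat : Type (max (u + 1) (v + 1)) := Marked LinStarCat.forget.{v, u}

/-- The category of marked `C^*`-categories. -/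
abbrev MarkedCStarCat : Type (max (u + 1) (v + 1)) := Marked CStarCat.forget.{v, u}

/-! ### Unitary and marked equivalences, cofibrations and fibrations -/

/-- Two morphisms of `*`-categories are unitarily isomorphic. -/
def UnitarilyIsomorphic {A B : StarCat.{v, u}} (F G : A ⟶ B) : Prop :=
  ∃ e : F.toFunctor ≅ G.toFunctor, ∀ a : A, IsUnitary (e.hom.app a)

/-- Two morphisms of `*`-categories are isomorphic through a transformation consisting of marked
morphisms. -/
def MarkedlyIsomorphic {A B : StarCat.{v, u}} (M : Marking B) (F G : A ⟶ B) : Prop :=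
  ∃ e : F.toFunctor ≅ G.toFunctor, ∀ a : A, M.marked (e.hom.app a)

section

variable {C : Type u₁} [Category.{v₁} C]

/-- The unitary equivalences in a category `C` of `*`-categories: the morphisms of `C` which have
an inverse in `C` up to unitary isomorphism. -/
def unitaryEquivalences (U : C ⥤ StarCat.{v, u}) : MorphismProperty C := fun A B f =>
  ∃ g : B ⟶ A, UnitarilyIsomorphic (U.map (f ≫ g)) (U.map (𝟙 A)) ∧
    UnitarilyIsomorphic (U.map (g ≫ f)) (U.map (𝟙 B))

/-- The marked equivalences in a category of marked `*`-categories: the morphisms which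
have an inverse up to marked isomorphism. -/
def markedEquivalences (U : C ⥤ StarCat.{v, u}) : MorphismProperty (Marked U) := fun A B f =>
  ∃ g : B ⟶ A, MarkedlyIsomorphic A.marking (U.map (f ≫ g).hom) (U.map (𝟙 A.obj)) ∧
    MarkedlyIsomorphic B.marking (U.map (g ≫ f).hom) (U.map (𝟙 B.obj))

/-- The morphisms which are injective on objects. -/
def injectiveOnObjects (U : C ⥤ StarCat.{v, u}) : MorphismProperty C := fun _ _ f =>
  Function.Injective (U.map f).obj

end

instance : CategoryWithWeakEquivalences StarCat.{v, u} := ⟨unitaryEquivalences (𝟭 _)⟩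
instance : CategoryWithCofibrations StarCat.{v, u} := ⟨injectiveOnObjects (𝟭 _)⟩
instance : CategoryWithFibrations StarCat.{v, u} := ⟨(trivialCofibrations StarCat.{v, u}).rlp⟩

instance : CategoryWithWeakEquivalences LinStarCat.{v, u} :=
  ⟨unitaryEquivalences LinStarCat.forget⟩
instance : CategoryWithCofibrations LinStarCat.{v, u} := ⟨injectiveOnObjects LinStarCat.forget⟩
instance : CategoryWithFibrations LinStarCat.{v, u} :=
  ⟨(trivialCofibrations LinStarCat.{v, u}).rlp⟩

instance : CategoryWithWeakEquivalences CStarCat.{v, u} := ⟨unitaryEquivalences CStarCat.forget⟩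
instance : CategoryWithCofibrations CStarCat.{v, u} := ⟨injectiveOnObjects CStarCat.forget⟩
instance : CategoryWithFibrations CStarCat.{v, u} := ⟨(trivialCofibrations CStarCat.{v, u}).rlp⟩

section

variable {C : Type u₁} [Category.{v₁} C] (U : C ⥤ StarCat.{v, u})

instance : CategoryWithWeakEquivalences (Marked U) := ⟨markedEquivalences U⟩
instance : CategoryWithCofibrations (Marked U) := ⟨injectiveOnObjects (Marked.forget U)⟩
instance : CategoryWithFibrations (Marked U) := ⟨(trivialCofibrations (Marked U)).rlp⟩

end

/-! ### The projective model structure on functor categories -/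

section

variable (I : Type u₁) [Category.{v₁} I] (C : Type u) [Category.{v} C]

/-- Projective weak equivalences: objectwise weak equivalences. -/
instance projectiveWeakEquivalences [CategoryWithWeakEquivalences C] :
    CategoryWithWeakEquivalences (I ⥤ C) :=
  ⟨fun _ _ f => ∀ i, weakEquivalences C (f.app i)⟩

/-- Projective fibrations: objectwise fibrations. -/
instance projectiveFibrations [CategoryWithFibrations C] : CategoryWithFibrations (I ⥤ C) :=
  ⟨fun _ _ f => ∀ i, fibrations C (f.app i)⟩

/-- Projective cofibrations: the morphisms with the left lifting property with respect to the
projective trivial fibrations. -/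
instance projectiveCofibrations [CategoryWithWeakEquivalences C] [CategoryWithFibrations C] :
    CategoryWithCofibrations (I ⥤ C) :=
  ⟨(trivialFibrations (I ⥤ C)).llp⟩

end

/-- A functor `L` with a natural transformation `ε : L ⟶ 𝟭` is a cofibrant replacement functor if
`L` takes cofibrant values and all components of `ε` are weak equivalences. -/
def IsCofibrantReplacement {C : Type u} [Category.{v} C] [Limits.HasInitial C]
    [CategoryWithWeakEquivalences C] [CategoryWithCofibrations C] (L : C ⥤ C) (ε : L ⟶ 𝟭 C) :
    Prop :=
  ∀ X : C, IsCofibrant (L.obj X) ∧ WeakEquivalence (ε.app X)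

/-! ### The groupoid of a group and the functor `D ↦ D ♯ G̃` -/

/-- The groupoid `G̃`: its objects are the elements of `G` and there is exactly one morphism
between any two objects. -/
def tildeGrpd (G : Type u) : Grpd.{v, u} :=
  { α := G
    str :=
      { Hom := fun _ _ => PUnit.{v + 1}
        id := fun _ => PUnit.unit
        comp := fun _ _ => PUnit.unit
        inv := fun _ => PUnit.unit } }

/-- A map of sets induces a functor between the groupoids `tildeGrpd`. -/
def tildeMap {G H : Type u} (f : G → H) : tildeGrpd.{v} G ⟶ tildeGrpd.{v} H where
  obj := f
  map _ := PUnit.unit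

/-- The groupoid `G̃` with the action of `G` by left multiplication, as an object of
`Fun(BG, Groupoids)`. -/
def tilde (G : Type u) [Group G] : SingleObj G ⥤ Grpd.{v, u} where
  obj _ := tildeGrpd.{v} G
  map g := tildeMap.{v} (fun h : G => (show G from g) * h)
  map_id _ := by
    have h : (fun h : G => (1 : G) * h) = fun h => h := funext one_mul
    exact congrArg tildeMap.{v} h
  map_comp g g' := by
    have h : (fun h : G => ((show G from g') * (show G from g)) * h) =
        fun h => (show G from g') * ((show G from g) * h) := funext (mul_assoc _ _)
    exact congrArg tildeMap.{v} h

section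

variable {C : Type u₁} [Category.{v₁} C] (G : Type u) [Group G]

/-- For a tensor structure `T = - ♯ -` of `C` over groupoids, the functor
`- ♯ G̃ : Fun(BG, C) ⥤ Fun(BG, C)`, with the diagonal action of `G` on `D ♯ G̃`. -/
def orbitReplacement (T : C × Grpd.{v, u} ⥤ C) : (SingleObj G ⥤ C) ⥤ (SingleObj G ⥤ C) where
  obj D := D.prod' (tilde.{v} G) ⋙ T
  map α := Functor.whiskerRight (NatTrans.prod' α (𝟙 (tilde.{v} G))) T
  map_id D := by
    ext x
    exact T.map_id _
  map_comp α β := by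
    ext x
    refine Eq.trans ?_ (T.map_comp _ _)
    congr 1

/-- The transformation `D ♯ G̃ ⟶ D` induced by the projections `π : A ♯ 𝔾 ⟶ A`. As `π` is natural
in the groupoid and is the identification `A ♯ * ≅ A` for the one-point groupoid, this is the
transformation induced by `G̃ ⟶ *`. -/
def orbitReplacementMap {T : C × Grpd.{v, u} ⥤ C} (π : T ⟶ CategoryTheory.Prod.fst C Grpd.{v, u}) :
    orbitReplacement G T ⟶ 𝟭 (SingleObj G ⥤ C) where
  app D :=
    { app := fun x => π.app (D.obj x, (tilde.{v} G).obj x)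
      naturality := fun x y g => π.naturality (((D.prod' (tilde.{v} G)).map g)) }
  naturality D E α := by
    ext x
    exact π.naturality ((NatTrans.prod' α (𝟙 (tilde.{v} G))).app x)

end

/-! ### The tensor structure of `*`-categories over groupoids -/

instance {A : Type u} [Category.{v} A] [StarCategory A] {𝔾 : Type u₁} [Groupoid.{v₁} 𝔾] :
    StarCategory (A × 𝔾) where
  invol f := (invol f.1, Groupoid.inv f.2)
  invol_invol f := by
    ext <;> simp
  invol_comp f g := by
    ext <;> simp

/-- A functor of groupoids preserves inverses. -/
theorem map_groupoid_inv {𝔾 ℍ : Grpd.{v, u}} (F : 𝔾 ⥤ ℍ) {X Y : 𝔾} (f : X ⟶ Y) :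
    F.map (Groupoid.inv f) = Groupoid.inv (F.map f) := by
  rw [Groupoid.inv_eq_inv, Groupoid.inv_eq_inv, Functor.map_inv]

/-- The tensor structure `(A, 𝔾) ↦ A × 𝔾` of `*`-categories over groupoids. -/
def starTensor : StarCat.{v, u} × Grpd.{v, u} ⥤ StarCat.{v, u} where
  obj P := { carrier := P.1 × P.2 }
  map {P Q} F :=
    { Functor.prod F.1.toFunctor (show P.2.α ⥤ Q.2.α from F.2) with
      map_invol := fun f => Prod.ext (F.1.map_invol f.1)
        (map_groupoid_inv (show P.2.α ⥤ Q.2.α from F.2) f.2) }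
  map_id _ := rfl
  map_comp _ _ := rfl

/-- The projections `A × 𝔾 ⟶ A`. -/
def starProj : starTensor.{v, u} ⟶ CategoryTheory.Prod.fst _ _ where
  app P := ({ CategoryTheory.Prod.fst P.1 P.2 with map_invol := fun _ => rfl } :
    StarFunctor (P.1 × P.2) P.1)
  naturality _ _ _ := rfl

/-! ### The tensor structure of `ℂ`-linear `*`-categories over groupoids -/

/-- The objects of `A ⊗ 𝔾` are pairs of objects. -/
structure LTens (A : Type u) (𝔾 : Type u₁) where
  fst : A
  snd : 𝔾

namespace LTens

section

variable {A : Type u} [Category.{v} A] [Preadditive A] {𝔾 : Type u₁} [Groupoid.{v₁} 𝔾]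

/-- The morphisms of `A ⊗ 𝔾`: the direct sum of copies of `Hom (a, a')` indexed by
`Hom (g, g')`. -/
abbrev Hom' (X Y : LTens A 𝔾) : Type (max v v₁) := (X.snd ⟶ Y.snd) →₀ (X.fst ⟶ Y.fst)

/-- The composition of `A ⊗ 𝔾`, the bilinear extension of
`(φ, f) ≫ (ψ, g) = (φ ≫ ψ, f ≫ g)`. -/
noncomputable def comp' {X Y Z : LTens A 𝔾} (x : Hom' X Y) (y : Hom' Y Z) : Hom' X Z :=
  x.sum fun φ f => y.sum fun ψ g => Finsupp.single (φ ≫ ψ) (f ≫ g)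

theorem single_comp' {X Y Z : LTens A 𝔾} (φ : X.snd ⟶ Y.snd) (f : X.fst ⟶ Y.fst)
    (ψ : Y.snd ⟶ Z.snd) (g : Y.fst ⟶ Z.fst) :
    comp' (Finsupp.single φ f : Hom' X Y) (Finsupp.single ψ g : Hom' Y Z) =
      Finsupp.single (φ ≫ ψ) (f ≫ g) := by
  unfold comp'
  rw [Finsupp.sum_single_index, Finsupp.sum_single_index] <;> simp

theorem add_comp' {X Y Z : LTens A 𝔾} (x x' : Hom' X Y) (y : Hom' Y Z) :
    comp' (x + x') y = comp' x y + comp' x' y := by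
  classical
  unfold comp'
  rw [Finsupp.sum_add_index']
  · simp
  · intro φ f f'
    simp [Finsupp.sum_add]

theorem comp_add' {X Y Z : LTens A 𝔾} (x : Hom' X Y) (y y' : Hom' Y Z) :
    comp' x (y + y') = comp' x y + comp' x y' := by
  classical
  unfold comp'
  rw [← Finsupp.sum_add]
  refine Finsupp.sum_congr fun φ _ => ?_
  rw [Finsupp.sum_add_index']
  · simp
  · intro ψ g g'
    simp

theorem zero_comp' {X Y Z : LTens A 𝔾} (y : Hom' Y Z) : comp' (0 : Hom' X Y) y = 0 := by
  simp [comp']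

theorem comp_zero' {X Y Z : LTens A 𝔾} (x : Hom' X Y) : comp' x (0 : Hom' Y Z) = 0 := by
  simp [comp']

noncomputable instance : Category (LTens A 𝔾) where
  Hom X Y := Hom' X Y
  id X := Finsupp.single (𝟙 X.snd) (𝟙 X.fst)
  comp x y := comp' x y
  id_comp {X Y} x := by
    induction x using Finsupp.induction_linear with
    | zero => exact comp_zero' _
    | add x y hx hy => exact (comp_add' _ _ _).trans (congrArg₂ _ hx hy)
    | single φ f => exact (single_comp' _ _ _ _).trans (by simp)
  comp_id {X Y} x := by
    induction x using Finsupp.induction_linear with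
    | zero => exact zero_comp' _
    | add x y hx hy => exact (add_comp' _ _ _).trans (congrArg₂ _ hx hy)
    | single φ f => exact (single_comp' _ _ _ _).trans (by simp)
  assoc {W X Y Z} x y z := by
    induction x using Finsupp.induction_linear with
    | zero => simp only [zero_comp']
    | add x x' hx hx' => simp only [add_comp', hx, hx']
    | single φ f =>
      induction y using Finsupp.induction_linear with
      | zero => simp only [zero_comp', comp_zero']
      | add y y' hy hy' => simp only [add_comp', comp_add', hy, hy']
      | single ψ g =>
        induction z using Finsupp.induction_linear with
        | zero => simp only [comp_zero']
        | add z z' hz hz' => simp only [comp_add', hz, hz']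
        | single χ h => simp only [single_comp', Category.assoc]

noncomputable instance : Preadditive (LTens A 𝔾) where
  homGroup X Y := inferInstanceAs (AddCommGroup (Hom' X Y))
  add_comp _ _ _ f f' g := add_comp' f f' g
  comp_add _ _ _ f g g' := comp_add' f g g'

/-- The generating morphisms `(φ, f)` of `A ⊗ 𝔾`. -/
noncomputable def single {X Y : LTens A 𝔾} (φ : X.snd ⟶ Y.snd) (f : X.fst ⟶ Y.fst) : X ⟶ Y :=
  (Finsupp.single φ f : Hom' X Y)

theorem single_comp {X Y Z : LTens A 𝔾} (φ : X.snd ⟶ Y.snd) (f : X.fst ⟶ Y.fst)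
    (ψ : Y.snd ⟶ Z.snd) (g : Y.fst ⟶ Z.fst) :
    (single φ f : X ⟶ Y) ≫ (single ψ g : Y ⟶ Z) = single (φ ≫ ψ) (f ≫ g) :=
  single_comp' φ f ψ g

theorem single_id (X : LTens A 𝔾) : (single (𝟙 X.snd) (𝟙 X.fst) : X ⟶ X) = 𝟙 X := rfl

theorem single_add {X Y : LTens A 𝔾} (φ : X.snd ⟶ Y.snd) (f f' : X.fst ⟶ Y.fst) :
    (single φ (f + f') : X ⟶ Y) = single φ f + single φ f' := Finsupp.single_add _ _ _

/-- Induction principle for the morphisms of `A ⊗ 𝔾`. -/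
theorem induction {X Y : LTens A 𝔾} {p : (X ⟶ Y) → Prop} (x : X ⟶ Y) (h0 : p 0)
    (hadd : ∀ x y, p x → p y → p (x + y)) (hs : ∀ φ f, p (single φ f)) : p x :=
  Finsupp.induction_linear x h0 hadd hs

theorem single_zero {X Y : LTens A 𝔾} (φ : X.snd ⟶ Y.snd) :
    (single φ 0 : X ⟶ Y) = 0 := Finsupp.single_zero _

/-- The additive extension of a family of additive maps to `A ⊗ 𝔾`. -/
noncomputable def lift {X Y : LTens A 𝔾} {M : Type*} [AddCommGroup M]
    (F : (X.snd ⟶ Y.snd) → (X.fst ⟶ Y.fst) →+ M) : (X ⟶ Y) →+ M :=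
  (Finsupp.liftAddHom F : Hom' X Y →+ M)

@[simp]
theorem lift_single {X Y : LTens A 𝔾} {M : Type*} [AddCommGroup M]
    (F : (X.snd ⟶ Y.snd) → (X.fst ⟶ Y.fst) →+ M) (φ : X.snd ⟶ Y.snd) (f : X.fst ⟶ Y.fst) :
    lift F (single φ f : X ⟶ Y) = F φ f :=
  Finsupp.liftAddHom_apply_single F φ f

theorem lift_ext {X Y : LTens A 𝔾} {M : Type*} [AddCommGroup M] {F F' : (X ⟶ Y) →+ M}
    (h : ∀ φ f, F (single φ f) = F' (single φ f)) (x : X ⟶ Y) : F x = F' x := by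
  induction x using induction with
  | h0 => simp
  | hadd x y hx hy => simp [hx, hy]
  | hs φ f => exact h φ f

variable [Linear ℂ A]

noncomputable instance (X Y : LTens A 𝔾) : Module ℂ (X ⟶ Y) :=
  inferInstanceAs (Module ℂ (Hom' X Y))

theorem smul_single {X Y : LTens A 𝔾} (c : ℂ) (φ : X.snd ⟶ Y.snd) (f : X.fst ⟶ Y.fst) :
    c • (single φ f : X ⟶ Y) = single φ (c • f) := Finsupp.smul_single _ _ _

noncomputable instance : Linear ℂ (LTens A 𝔾) where
  smul_comp X Y Z c x y := by
    induction x using induction with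
    | h0 => simp
    | hadd x x' hx hx' => simp [hx, hx']
    | hs φ f =>
      induction y using induction with
      | h0 => simp
      | hadd y y' hy hy' => simp [hy, hy']
      | hs ψ g => simp [smul_single, single_comp]
  comp_smul X Y Z x c y := by
    induction x using induction with
    | h0 => simp
    | hadd x x' hx hx' => simp [hx, hx']
    | hs φ f =>
      induction y using induction with
      | h0 => simp
      | hadd y y' hy hy' => simp [hy, hy']
      | hs ψ g => simp [smul_single, single_comp]

theorem lift_smul {X Y : LTens A 𝔾} {M : Type*} [AddCommGroup M] [Module ℂ M]
    (F : (X.snd ⟶ Y.snd) → (X.fst ⟶ Y.fst) →+ M) (h : ∀ φ (c : ℂ) f, F φ (c • f) = c • F φ f)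
    (c : ℂ) (x : X ⟶ Y) : lift F (c • x) = c • lift F x := by
  induction x using induction with
  | h0 => simp
  | hadd x y hx hy => simp [hx, hy]
  | hs φ f => simp [smul_single, h]

variable [LinearStarCategory A]

/-- The involution of `A ⊗ 𝔾`, the additive extension of `(φ, f) ↦ (φ⁻¹, f^*)`. -/
noncomputable def invol' {X Y : LTens A 𝔾} : (X ⟶ Y) →+ (Y ⟶ X) :=
  lift fun φ =>
    { toFun := fun f => single (Groupoid.inv φ) (invol f)
      map_zero' := by
        rw [LinearStarCategory.invol_zero, single_zero]
      map_add' := fun f g => by rw [LinearStarCategory.invol_add, single_add] }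

@[simp]
theorem invol'_single {X Y : LTens A 𝔾} (φ : X.snd ⟶ Y.snd) (f : X.fst ⟶ Y.fst) :
    invol' (single φ f : X ⟶ Y) = single (Groupoid.inv φ) (invol f) :=
  lift_single _ _ _

noncomputable instance : LinearStarCategory (LTens A 𝔾) where
  invol x := invol' x
  invol_invol x := by
    induction x using induction with
    | h0 => simp
    | hadd x y hx hy => simp [hx, hy]
    | hs φ f => simp
  invol_comp x y := by
    induction x using induction with
    | h0 => simp
    | hadd x x' hx hx' => simp [hx, hx']
    | hs φ f =>
      induction y using induction with
      | h0 => simp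
      | hadd y y' hy hy' => simp [hy, hy']
      | hs ψ g => simp [single_comp]
  invol_add x y := by simp
  invol_smul c x := by
    induction x using induction with
    | h0 => simp
    | hadd x y hx hy => simp [hx, hy]
    | hs φ f => simp [smul_single, LinearStarCategory.invol_smul]

@[simp]
theorem invol_single {X Y : LTens A 𝔾} (φ : X.snd ⟶ Y.snd) (f : X.fst ⟶ Y.fst) :
    invol (single φ f : X ⟶ Y) = single (Groupoid.inv φ) (invol f) :=
  invol'_single φ f

/-- A unitary morphism `f` of `A` and a morphism `φ` of `𝔾` give a unitary `(φ, f)`. -/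
theorem isUnitary_single {X Y : LTens A 𝔾} (φ : X.snd ⟶ Y.snd) {f : X.fst ⟶ Y.fst}
    (hf : IsUnitary f) : IsUnitary (single φ f : X ⟶ Y) := by
  constructor
  · rw [invol_single, single_comp, hf.1, Groupoid.comp_inv, single_id]
  · rw [invol_single, single_comp, hf.2, Groupoid.inv_comp, single_id]

end

section

variable {A : Type u} [Category.{v} A] [Preadditive A] [Linear ℂ A] [LinearStarCategory A]
variable {B : Type u} [Category.{v} B] [Preadditive B] [Linear ℂ B] [LinearStarCategory B]
variable {𝔾 ℍ : Grpd.{v, u}}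

/-- The action of `F ⊗ Φ` on morphisms, the additive extension of `(φ, f) ↦ (Φ φ, F f)`. -/
noncomputable def mapHom (F : LinStarFunctor A B) (Φ : 𝔾 ⥤ ℍ) {X Y : LTens A 𝔾} :
    (X ⟶ Y) →+ ((⟨F.obj X.fst, Φ.obj X.snd⟩ : LTens B ℍ) ⟶ ⟨F.obj Y.fst, Φ.obj Y.snd⟩) :=
  lift fun φ =>
    { toFun := fun f => single (Φ.map φ) (F.map f)
      map_zero' := by
        rw [F.map_zero]
        exact single_zero _
      map_add' := fun f g => by
        rw [F.map_add]
        exact single_add _ _ _ }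

theorem mapHom_single (F : LinStarFunctor A B) (Φ : 𝔾 ⥤ ℍ) {X Y : LTens A 𝔾}
    (φ : X.snd ⟶ Y.snd) (f : X.fst ⟶ Y.fst) :
    mapHom F Φ (single φ f : X ⟶ Y) = single (Φ.map φ) (F.map f) :=
  lift_single _ _ _

/-- The functoriality of `A ⊗ 𝔾`. -/
noncomputable def map (F : LinStarFunctor A B) (Φ : 𝔾 ⥤ ℍ) :
    LinStarFunctor (LTens A 𝔾) (LTens B ℍ) where
  obj X := ⟨F.obj X.fst, Φ.obj X.snd⟩
  map x := mapHom F Φ x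
  map_id X := by
    rw [← single_id, mapHom_single, F.map_id, Φ.map_id]
    exact single_id _
  map_comp x y := by
    induction x using induction with
    | h0 => simp
    | hadd x x' hx hx' => simp [hx, hx']
    | hs φ f =>
      induction y using induction with
      | h0 => simp
      | hadd y y' hy hy' => simp [hy, hy']
      | hs ψ g =>
        rw [single_comp, mapHom_single, mapHom_single, mapHom_single, single_comp, F.map_comp,
          Φ.map_comp]
  map_invol x := by
    induction x using induction with
    | h0 => simp [LinearStarCategory.invol_zero]
    | hadd x y hx hy => simp [LinearStarCategory.invol_add, hx, hy]
    | hs φ f =>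
      rw [invol_single, mapHom_single, mapHom_single, invol_single, F.map_invol,
        map_groupoid_inv]
  map_add x y := by simp
  map_smul {X Y} c x := by
    refine lift_smul _ (fun φ c f => ?_) c x
    let X' : LTens B ℍ := ⟨F.obj X.fst, Φ.obj X.snd⟩
    let Y' : LTens B ℍ := ⟨F.obj Y.fst, Φ.obj Y.snd⟩
    exact (congrArg (fun k => (single (Φ.map φ) k : X' ⟶ Y')) (F.map_smul c f)).trans
      (smul_single (X := X') (Y := Y') c (Φ.map φ) (F.map f)).symm

/-- The projection `A ⊗ 𝔾 ⟶ A` on morphisms, the additive extension of `(φ, f) ↦ f`. -/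
noncomputable def projHom {X Y : LTens A 𝔾} : (X ⟶ Y) →+ (X.fst ⟶ Y.fst) :=
  lift fun _ => AddMonoidHom.id _

theorem projHom_single {X Y : LTens A 𝔾} (φ : X.snd ⟶ Y.snd) (f : X.fst ⟶ Y.fst) :
    projHom (single φ f : X ⟶ Y) = f :=
  lift_single _ _ _

variable (A 𝔾) in
/-- The projection `A ⊗ 𝔾 ⟶ A`. -/
noncomputable def proj : LinStarFunctor (LTens A 𝔾) A where
  obj X := X.fst
  map x := projHom x
  map_id X := projHom_single _ _
  map_comp x y := by
    induction x using induction with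
    | h0 => simp
    | hadd x x' hx hx' => simp [hx, hx']
    | hs φ f =>
      induction y using induction with
      | h0 => simp
      | hadd y y' hy hy' => simp [hy, hy']
      | hs ψ g => simp only [single_comp, projHom_single]
  map_invol x := by
    induction x using induction with
    | h0 => simp [LinearStarCategory.invol_zero]
    | hadd x y hx hy => simp [LinearStarCategory.invol_add, hx, hy]
    | hs φ f => simp only [invol_single, projHom_single]
  map_add x y := by simp
  map_smul c x := lift_smul _ (fun _ _ _ => rfl) c x

/-- Morphisms out of `A ⊗ 𝔾` are determined on the objects and on the morphisms `(φ, f)`. -/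
theorem functor_ext {F F' : LinStarFunctor (LTens A 𝔾) B} (hobj : ∀ X, F.obj X = F'.obj X)
    (h : ∀ {X Y : LTens A 𝔾} (φ : X.snd ⟶ Y.snd) (f : X.fst ⟶ Y.fst),
      F.map (single φ f : X ⟶ Y) ≍ F'.map (single φ f : X ⟶ Y)) : F = F' := by
  obtain ⟨⟨⟨o, m, _, _⟩, _⟩, ha, _⟩ := F
  obtain ⟨⟨⟨o', m', _, _⟩, _⟩, ha', _⟩ := F'
  obtain rfl : o = o' := funext hobj
  refine LinStarFunctor.ext_functor (CategoryTheory.Functor.hext (fun _ => rfl)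
    fun X Y x => heq_of_eq ?_)
  exact lift_ext (F := AddMonoidHom.mk' m ha) (F' := AddMonoidHom.mk' m' ha')
    (fun φ f => eq_of_heq (h φ f)) x

end
end LTens

/-- The tensor structure `(A, 𝔾) ↦ A ⊗ 𝔾` of `ℂ`-linear `*`-categories over groupoids. -/
noncomputable def linTensor : LinStarCat.{v, u} × Grpd.{v, u} ⥤ LinStarCat.{v, u} where
  obj P := { carrier := LTens P.1 P.2 }
  map {P Q} F := LTens.map F.1 (show P.2.α ⥤ Q.2.α from F.2)
  map_id _ := LTens.functor_ext (fun _ => rfl) fun φ f => heq_of_eq (LTens.mapHom_single _ _ φ f)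
  map_comp {P Q R} F G := LTens.functor_ext (fun _ => rfl) fun φ f => heq_of_eq <|
    (LTens.mapHom_single _ _ φ f).trans <| Eq.symm <|
      (congrArg (LTens.mapHom G.1 (show Q.2.α ⥤ R.2.α from G.2))
        (LTens.mapHom_single F.1 (show P.2.α ⥤ Q.2.α from F.2) φ f)).trans
      (LTens.mapHom_single _ _ _ _)

/-- The projections `A ⊗ 𝔾 ⟶ A`. -/
noncomputable def linProj : linTensor.{v, u} ⟶ CategoryTheory.Prod.fst _ _ where
  app P := LTens.proj P.1 P.2
  naturality P Q F := LTens.functor_ext (fun _ => rfl) fun φ f => heq_of_eq <|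
    ((congrArg LTens.projHom
        (LTens.mapHom_single F.1 (show P.2.α ⥤ Q.2.α from F.2) φ f)).trans
      (LTens.projHom_single _ _)).trans <| Eq.symm <|
      congrArg F.1.map (LTens.projHom_single φ f)

/-! ### The completion of a pre-`C^*`-category -/

section MaxNorm

variable {A : Type u} [Category.{v} A] [Preadditive A] [Linear ℂ A] [LinearStarCategory A]

theorem enorm_le_maxNorm {B : Type (max u v)} [i : NonUnitalCStarAlgebra B] (ρ : StarRep A B)
    {X Y : A} (f : X ⟶ Y) : ‖ρ.toFun f‖ₑ ≤ maxNorm f :=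
  le_iSup_of_le B (le_iSup_of_le i (le_iSup_of_le ρ le_rfl))

theorem maxNorm_le {X Y : A} {f : X ⟶ Y} {c : ℝ≥0∞}
    (h : ∀ (B : Type (max u v)) (_ : NonUnitalCStarAlgebra B) (ρ : StarRep A B),
      ‖ρ.toFun f‖ₑ ≤ c) : maxNorm f ≤ c :=
  iSup_le fun B => iSup_le fun i => iSup_le fun ρ => h B i ρ

theorem StarRep.map_zero {B : Type (max u v)} [NonUnitalCStarAlgebra B] (ρ : StarRep A B)
    (X Y : A) : ρ.toFun (0 : X ⟶ Y) = 0 := by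
  simpa using ρ.map_smul 0 (0 : X ⟶ Y)

theorem maxNorm_zero (X Y : A) : maxNorm (0 : X ⟶ Y) = 0 :=
  le_antisymm (maxNorm_le fun B _ ρ => by simp [ρ.map_zero]) bot_le

theorem maxNorm_add_le {X Y : A} (f g : X ⟶ Y) : maxNorm (f + g) ≤ maxNorm f + maxNorm g :=
  maxNorm_le fun B _ ρ => by
    rw [ρ.map_add]
    exact (enorm_add_le _ _).trans (add_le_add (enorm_le_maxNorm ρ f) (enorm_le_maxNorm ρ g))

theorem maxNorm_smul_le {X Y : A} (c : ℂ) (f : X ⟶ Y) :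
    maxNorm (c • f) ≤ ‖c‖ₑ * maxNorm f :=
  maxNorm_le fun B _ ρ => by
    rw [ρ.map_smul, enorm_smul]
    gcongr
    exact enorm_le_maxNorm ρ f

theorem maxNorm_comp_le {X Y Z : A} (f : X ⟶ Y) (g : Y ⟶ Z) :
    maxNorm (f ≫ g) ≤ maxNorm f * maxNorm g :=
  maxNorm_le fun B _ ρ => by
    rw [ρ.map_comp, mul_comm]
    refine le_trans ?_ (mul_le_mul' (enorm_le_maxNorm ρ g) (enorm_le_maxNorm ρ f))
    rw [enorm_eq_nnnorm, enorm_eq_nnnorm, enorm_eq_nnnorm]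
    exact_mod_cast nnnorm_mul_le _ _

theorem maxNorm_invol_le {X Y : A} (f : X ⟶ Y) : maxNorm (invol f) ≤ maxNorm f :=
  maxNorm_le fun B _ ρ => by
    rw [ρ.map_invol]
    refine le_trans (le_of_eq ?_) (enorm_le_maxNorm ρ f)
    rw [enorm_eq_nnnorm, enorm_eq_nnnorm, nnnorm_star]

theorem maxNorm_invol {X Y : A} (f : X ⟶ Y) : maxNorm (invol f) = maxNorm f :=
  le_antisymm (maxNorm_invol_le f) (by simpa using maxNorm_invol_le (invol f))

theorem maxNorm_sq_le {X Y : A} (f : X ⟶ Y) :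
    maxNorm f * maxNorm f ≤ maxNorm (f ≫ invol f) := by
  have h : maxNorm f ≤ maxNorm (f ≫ invol f) ^ (1 / 2 : ℝ) := maxNorm_le fun B _ ρ => by
    have h1 : ‖ρ.toFun f‖ₑ * ‖ρ.toFun f‖ₑ ≤ maxNorm (f ≫ invol f) := by
      refine le_trans (le_of_eq ?_) (enorm_le_maxNorm ρ _)
      rw [ρ.map_comp, ρ.map_invol, enorm_eq_nnnorm, enorm_eq_nnnorm,
        CStarRing.nnnorm_star_mul_self, ENNReal.coe_mul]
    rw [← pow_two, ← ENNReal.rpow_natCast] at h1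
    have h2 := ENNReal.rpow_le_rpow h1 (by norm_num : (0 : ℝ) ≤ 1 / 2)
    rwa [← ENNReal.rpow_mul, show ((2 : ℕ) : ℝ) * (1 / 2) = 1 by norm_num,
      ENNReal.rpow_one] at h2
  refine (mul_le_mul' h h).trans (le_of_eq ?_)
  rw [← ENNReal.rpow_add_of_nonneg _ _ (by norm_num) (by norm_num)]
  norm_num

/-- Morphisms of `ℂ`-linear `*`-categories do not increase the maximal norm. -/
theorem maxNorm_map_le {B : Type u} [Category.{v} B] [Preadditive B] [Linear ℂ B]
    [LinearStarCategory B] (F : LinStarFunctor A B) {X Y : A} (f : X ⟶ Y) :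
    maxNorm (F.map f) ≤ maxNorm f :=
  maxNorm_le fun D _ ρ => enorm_le_maxNorm
    ({ toFun := fun f => ρ.toFun (F.map f)
       map_add := fun f g => by rw [F.map_add, ρ.map_add]
       map_smul := fun c f => by rw [F.map_smul, ρ.map_smul]
       map_comp := fun f g => by rw [F.map_comp, ρ.map_comp]
       map_invol := fun f => by rw [F.map_invol, ρ.map_invol] } : StarRep A D) f

/-- A representation sends a morphism `f` with `f f^* = id` to a partial isometry. -/
theorem maxNorm_le_one {X Y : A} (f : X ⟶ Y) (hf : f ≫ invol f = 𝟙 X) : maxNorm f ≤ 1 :=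
  maxNorm_le fun B _ ρ => by
    have h1 : star (ρ.toFun f) * ρ.toFun f = ρ.toFun (𝟙 X) := by
      rw [← ρ.map_invol, ← ρ.map_comp, hf]
    have h2 : ρ.toFun f * ρ.toFun (𝟙 X) = ρ.toFun f := by
      rw [← ρ.map_comp, Category.id_comp]
    have h3 : ‖ρ.toFun (𝟙 X)‖ = ‖ρ.toFun f‖ * ‖ρ.toFun f‖ := by
      rw [← h1, CStarRing.norm_star_mul_self]
    have h4 : ρ.toFun (𝟙 X) * ρ.toFun (𝟙 X) = ρ.toFun (𝟙 X) := by
      rw [← ρ.map_comp, Category.id_comp]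
    have h5 : star (ρ.toFun (𝟙 X)) = ρ.toFun (𝟙 X) := by
      rw [← ρ.map_invol, invol_id]
    have h6 : ‖ρ.toFun (𝟙 X)‖ = ‖ρ.toFun (𝟙 X)‖ * ‖ρ.toFun (𝟙 X)‖ := by
      rw [← CStarRing.norm_star_mul_self, h5, h4]
    have h7 : ‖ρ.toFun f‖ ≤ 1 := by
      by_contra h
      push Not at h
      have h8 : 1 < ‖ρ.toFun (𝟙 X)‖ := by rw [h3]; nlinarith
      nlinarith
    rw [enorm_eq_nnnorm]
    exact_mod_cast h7

end MaxNorm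

/-- If `A` is a pre-`C^*`-category, then so is `A ⊗ 𝔾`. -/
instance {A : Type u} [Category.{v} A] [Preadditive A] [Linear ℂ A] [LinearStarCategory A]
    [IsPreCStar A] (𝔾 : Grpd.{v, u}) : IsPreCStar (LTens A 𝔾) where
  maxNorm_ne_top {X Y} x := by
    induction x using LTens.induction with
    | h0 => rw [maxNorm_zero]; exact ENNReal.zero_ne_top
    | hadd x y hx hy =>
      exact ne_top_of_le_ne_top (ENNReal.add_ne_top.2 ⟨hx, hy⟩) (maxNorm_add_le x y)
    | hs φ f =>
      let F : LinStarFunctor A (LTens A 𝔾) :=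
        { obj := fun a => ⟨a, X.snd⟩
          map := fun f => LTens.single (𝟙 X.snd) f
          map_id := fun a => rfl
          map_comp := fun f g => by rw [LTens.single_comp, Category.comp_id]
          map_invol := fun f => by rw [LTens.invol_single]; simp
          map_add := fun f g => LTens.single_add _ _ _
          map_smul := fun c f => (LTens.smul_single _ _ _).symm }
      let u : (⟨Y.fst, X.snd⟩ : LTens A 𝔾) ⟶ Y := LTens.single φ (𝟙 Y.fst)
      have hu : maxNorm u ≤ 1 := maxNorm_le_one u (by
        simp only [u]
        rw [LTens.invol_single, LTens.single_comp, invol_id, Category.comp_id, Groupoid.comp_inv]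
        rfl)
      have h : (LTens.single φ f : X ⟶ Y) = F.map f ≫ u := by
        refine Eq.trans ?_ (LTens.single_comp (X := X) (Y := ⟨Y.fst, X.snd⟩) _ _ _ _).symm
        simp
      rw [h]
      refine ne_top_of_le_ne_top ?_ (maxNorm_comp_le _ _)
      exact ENNReal.mul_ne_top
        (ne_top_of_le_ne_top (IsPreCStar.maxNorm_ne_top f) (maxNorm_map_le F f))
        (ne_top_of_le_ne_top ENNReal.one_ne_top hu)

section Completion

open UniformSpace

variable {A : Type u} [Category.{v} A] [Preadditive A] [Linear ℂ A] [LinearStarCategory A]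

/-- The maximal norm as a real number. -/
noncomputable instance homNorm (X Y : A) : Norm (X ⟶ Y) := ⟨fun f => (maxNorm f).toReal⟩

theorem norm_def {X Y : A} (f : X ⟶ Y) : ‖f‖ = (maxNorm f).toReal := rfl

variable [IsPreCStar A]

theorem ofReal_norm {X Y : A} (f : X ⟶ Y) : ENNReal.ofReal ‖f‖ = maxNorm f :=
  ENNReal.ofReal_toReal (IsPreCStar.maxNorm_ne_top f)

theorem norm_le_of_maxNorm_le {X Y : A} {f : X ⟶ Y} {c : ℝ} (hc : 0 ≤ c)
    (h : maxNorm f ≤ ENNReal.ofReal c) : ‖f‖ ≤ c := by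
  rw [← ofReal_norm] at h
  exact (ENNReal.ofReal_le_ofReal_iff hc).1 h

theorem norm_smul_le' {X Y : A} (c : ℂ) (f : X ⟶ Y) : ‖c • f‖ ≤ ‖c‖ * ‖f‖ := by
  refine norm_le_of_maxNorm_le (mul_nonneg (norm_nonneg c) ENNReal.toReal_nonneg) ?_
  rw [ENNReal.ofReal_mul (norm_nonneg c), ofReal_norm, _root_.ofReal_norm]
  exact maxNorm_smul_le c f

theorem seminormedCore (X Y : A) : SeminormedSpace.Core ℂ (X ⟶ Y) where
  norm_nonneg _ := ENNReal.toReal_nonneg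
  norm_smul c f := by
    refine le_antisymm (norm_smul_le' c f) ?_
    by_cases hc : c = 0
    · rw [hc, norm_zero, zero_mul]
      exact ENNReal.toReal_nonneg
    · have h := norm_smul_le' c⁻¹ (c • f)
      rw [smul_smul, inv_mul_cancel₀ hc, one_smul, norm_inv] at h
      rwa [mul_comm, ← le_div_iff₀ (norm_pos_iff.2 hc), div_eq_inv_mul]
  norm_triangle f g := by
    refine norm_le_of_maxNorm_le (add_nonneg ENNReal.toReal_nonneg ENNReal.toReal_nonneg) ?_
    refine le_trans ?_ (le_of_eq (ENNReal.ofReal_add (p := ‖f‖) (q := ‖g‖)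
      ENNReal.toReal_nonneg ENNReal.toReal_nonneg).symm)
    rw [ofReal_norm, ofReal_norm]
    exact maxNorm_add_le f g

noncomputable instance homSeminormed (X Y : A) : SeminormedAddCommGroup (X ⟶ Y) :=
  SeminormedAddCommGroup.ofCore (seminormedCore X Y)

noncomputable instance homNormedSpace (X Y : A) : NormedSpace ℂ (X ⟶ Y) :=
  { (inferInstance : Module ℂ (X ⟶ Y)) with
    norm_smul_le := norm_smul_le' }

theorem norm_comp_le {X Y Z : A} (f : X ⟶ Y) (g : Y ⟶ Z) : ‖f ≫ g‖ ≤ ‖f‖ * ‖g‖ := by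
  refine norm_le_of_maxNorm_le (mul_nonneg (norm_nonneg f) (norm_nonneg g)) ?_
  rw [ENNReal.ofReal_mul (norm_nonneg f), ofReal_norm, ofReal_norm]
  exact maxNorm_comp_le f g

theorem norm_invol {X Y : A} (f : X ⟶ Y) : ‖invol f‖ = ‖f‖ := by
  rw [norm_def, norm_def, maxNorm_invol]

theorem norm_sq_le {X Y : A} (f : X ⟶ Y) : ‖f‖ * ‖f‖ ≤ ‖f ≫ invol f‖ := by
  rw [norm_def, norm_def, ← ENNReal.toReal_mul]
  exact ENNReal.toReal_mono (IsPreCStar.maxNorm_ne_top _) (maxNorm_sq_le f)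

theorem norm_rep_le {B : Type (max u v)} [NonUnitalCStarAlgebra B] (ρ : StarRep A B)
    {X Y : A} (f : X ⟶ Y) : ‖ρ.toFun f‖ ≤ ‖f‖ := by
  have h := enorm_le_maxNorm ρ f
  rw [← ofReal_norm, ← _root_.ofReal_norm] at h
  exact (ENNReal.ofReal_le_ofReal_iff (norm_nonneg f)).1 h

/-- The composition as a bounded bilinear map. -/
theorem continuous_comp' (X Y Z : A) :
    Continuous fun p : (X ⟶ Y) × (Y ⟶ Z) => (p.1 ≫ p.2 : X ⟶ Z) :=
  (show IsBoundedBilinearMap ℂ fun p : (X ⟶ Y) × (Y ⟶ Z) => (p.1 ≫ p.2 : X ⟶ Z) from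
    { add_left := fun f f' g => Preadditive.add_comp _ _ _ f f' g
      smul_left := fun c f g => Linear.smul_comp _ _ _ c f g
      add_right := fun f g g' => Preadditive.comp_add _ _ _ f g g'
      smul_right := fun c f g => Linear.comp_smul _ _ _ f c g
      bound := ⟨1, one_pos, fun f g => by simpa using norm_comp_le f g⟩ }).continuous

variable (A) in
/-- The objects of the completion of `A` are those of `A`. -/
structure Compl where
  as : A

namespace Compl

/-- The morphism spaces of the completion of `A` are the completions of those of `A` with respect
to the maximal norm (with morphisms of norm zero divided out). -/
abbrev Hom' (X Y : Compl A) : Type v := Completion (X.as ⟶ Y.as)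

/-- The continuous extension of the composition. -/
noncomputable def comp' {X Y Z : Compl A} (f : Hom' X Y) (g : Hom' Y Z) : Hom' X Z :=
  (Completion.isDenseInducing_coe.prodMap Completion.isDenseInducing_coe).extend
    (fun p : (X.as ⟶ Y.as) × (Y.as ⟶ Z.as) => ((p.1 ≫ p.2 : X.as ⟶ Z.as) : Hom' X Z)) (f, g)

theorem coe_comp' {X Y Z : Compl A} (f : X.as ⟶ Y.as) (g : Y.as ⟶ Z.as) :
    comp' (f : Hom' X Y) (g : Hom' Y Z) = ((f ≫ g : X.as ⟶ Z.as) : Hom' X Z) :=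
  (Completion.isDenseInducing_coe.prodMap Completion.isDenseInducing_coe).extend_eq
    ((Completion.continuous_coe _).comp (continuous_comp' _ _ _)) (f, g)

theorem continuous_comp'' (X Y Z : Compl A) :
    Continuous fun p : Hom' X Y × Hom' Y Z => (comp' p.1 p.2 : Hom' X Z) := by
  let m : (X.as ⟶ Y.as) →+ (Y.as ⟶ Z.as) →+ Hom' X Z :=
    AddMonoidHom.mk' (fun f => AddMonoidHom.mk' (fun g => ((f ≫ g : X.as ⟶ Z.as) : Hom' X Z))
      (fun g g' => by rw [Preadditive.comp_add, Completion.coe_add]))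
      (fun f f' => by
        ext g
        simp [Preadditive.add_comp, Completion.coe_add])
  have hm : Continuous fun p : (X.as ⟶ Y.as) × (Y.as ⟶ Z.as) => m p.1 p.2 :=
    (Completion.continuous_coe _).comp (continuous_comp' _ _ _)
  have d1 : IsDenseInducing (Completion.toCompl : (X.as ⟶ Y.as) → Hom' X Y) :=
    Completion.isDenseInducing_coe
  have d2 : IsDenseInducing (Completion.toCompl : (Y.as ⟶ Z.as) → Hom' Y Z) :=
    Completion.isDenseInducing_coe
  exact (d1.extend_Z_bilin d2 hm :)

theorem cont_comp {T : Type*} [TopologicalSpace T] {X Y Z : Compl A}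
    {f : T → Hom' X Y} {g : T → Hom' Y Z} (hf : Continuous f) (hg : Continuous g) :
    Continuous fun t => (comp' (f t) (g t) : Hom' X Z) :=
  (continuous_comp'' X Y Z).comp (hf.prodMk hg)

noncomputable instance : Category (Compl A) where
  Hom X Y := Hom' X Y
  id X := ((𝟙 X.as : X.as ⟶ X.as) : Hom' X X)
  comp f g := comp' f g
  id_comp {X Y} f := by
    induction f using Completion.induction_on with
    | hp => exact isClosed_eq (cont_comp continuous_const continuous_id) continuous_id
    | ih f => rw [coe_comp', Category.id_comp]
  comp_id {X Y} f := by
    induction f using Completion.induction_on with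
    | hp => exact isClosed_eq (cont_comp continuous_id continuous_const) continuous_id
    | ih f => rw [coe_comp', Category.comp_id]
  assoc {W X Y Z} f g h := by
    induction f, g, h using Completion.induction_on₃ with
    | hp =>
      exact isClosed_eq
        (cont_comp (cont_comp continuous_fst (continuous_fst.comp continuous_snd))
          (continuous_snd.comp continuous_snd))
        (cont_comp continuous_fst
          (cont_comp (continuous_fst.comp continuous_snd) (continuous_snd.comp continuous_snd)))
    | ih f g h => rw [coe_comp', coe_comp', coe_comp', coe_comp', Category.assoc]

/-- The image of a morphism of `A` in the completion. -/
noncomputable def of {X Y : Compl A} (f : X.as ⟶ Y.as) : X ⟶ Y := (f : Hom' X Y)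

theorem of_comp {X Y Z : Compl A} (f : X.as ⟶ Y.as) (g : Y.as ⟶ Z.as) :
    (of (f ≫ g) : X ⟶ Z) = (of f : X ⟶ Y) ≫ (of g : Y ⟶ Z) := (coe_comp' f g).symm

theorem of_id (X : Compl A) : (of (𝟙 X.as) : X ⟶ X) = 𝟙 X := rfl

theorem add_comp' {X Y Z : Compl A} (f f' : Hom' X Y) (g : Hom' Y Z) :
    comp' (f + f') g = comp' f g + comp' f' g := by
  induction f, f', g using Completion.induction_on₃ with
  | hp =>
    exact isClosed_eq
      (cont_comp (continuous_fst.add (continuous_fst.comp continuous_snd))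
        (continuous_snd.comp continuous_snd))
      ((cont_comp continuous_fst (continuous_snd.comp continuous_snd)).add
        (cont_comp (continuous_fst.comp continuous_snd) (continuous_snd.comp continuous_snd)))
  | ih f f' g =>
    rw [← Completion.coe_add, coe_comp', coe_comp', coe_comp', Preadditive.add_comp,
      Completion.coe_add]

theorem comp_add' {X Y Z : Compl A} (f : Hom' X Y) (g g' : Hom' Y Z) :
    comp' f (g + g') = comp' f g + comp' f g' := by
  induction f, g, g' using Completion.induction_on₃ with
  | hp =>
    exact isClosed_eq
      (cont_comp continuous_fst
        ((continuous_fst.comp continuous_snd).add (continuous_snd.comp continuous_snd)))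
      ((cont_comp continuous_fst (continuous_fst.comp continuous_snd)).add
        (cont_comp continuous_fst (continuous_snd.comp continuous_snd)))
  | ih f g g' =>
    rw [← Completion.coe_add, coe_comp', coe_comp', coe_comp', Preadditive.comp_add,
      Completion.coe_add]

noncomputable instance : Preadditive (Compl A) where
  homGroup X Y := inferInstanceAs (AddCommGroup (Hom' X Y))
  add_comp _ _ _ f f' g := add_comp' f f' g
  comp_add _ _ _ f g g' := comp_add' f g g'

theorem smul_comp' {X Y Z : Compl A} (c : ℂ) (f : Hom' X Y) (g : Hom' Y Z) :
    comp' (c • f) g = c • comp' f g := by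
  induction f, g using Completion.induction_on₂ with
  | hp =>
    exact isClosed_eq (cont_comp (continuous_fst.const_smul c) continuous_snd)
      ((cont_comp continuous_fst continuous_snd).const_smul c)
  | ih f g =>
    rw [← Completion.coe_smul, coe_comp', coe_comp', Linear.smul_comp, Completion.coe_smul]

theorem comp_smul' {X Y Z : Compl A} (c : ℂ) (f : Hom' X Y) (g : Hom' Y Z) :
    comp' f (c • g) = c • comp' f g := by
  induction f, g using Completion.induction_on₂ with
  | hp =>
    exact isClosed_eq (cont_comp continuous_fst (continuous_snd.const_smul c))
      ((cont_comp continuous_fst continuous_snd).const_smul c)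
  | ih f g =>
    rw [← Completion.coe_smul, coe_comp', coe_comp', Linear.comp_smul, Completion.coe_smul]

noncomputable instance : Linear ℂ (Compl A) where
  homModule X Y := inferInstanceAs (Module ℂ (Hom' X Y))
  smul_comp _ _ _ c f g := smul_comp' c f g
  comp_smul _ _ _ f c g := comp_smul' c f g

theorem uniformContinuous_invol (X Y : A) :
    UniformContinuous (fun f : X ⟶ Y => (invol f : Y ⟶ X)) :=
  (AddMonoidHomClass.isometry_of_norm
    (AddMonoidHom.mk' (fun f : X ⟶ Y => (invol f : Y ⟶ X)) LinearStarCategory.invol_add)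
    norm_invol).uniformContinuous

/-- The continuous extension of the involution. -/
noncomputable def invol' {X Y : Compl A} : Hom' X Y → Hom' Y X :=
  Completion.map (fun f : X.as ⟶ Y.as => (invol f : Y.as ⟶ X.as))

theorem continuous_invol' {X Y : Compl A} : Continuous (invol' : Hom' X Y → Hom' Y X) :=
  Completion.continuous_map

theorem invol'_coe {X Y : Compl A} (f : X.as ⟶ Y.as) :
    invol' (f : Hom' X Y) = ((invol f : Y.as ⟶ X.as) : Hom' Y X) :=
  Completion.map_coe (uniformContinuous_invol _ _) f

noncomputable instance : LinearStarCategory (Compl A) where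
  invol f := invol' f
  invol_invol {X Y} f := by
    change Hom' X Y at f
    change invol' (invol' f) = f
    induction f using Completion.induction_on with
    | hp => exact isClosed_eq (continuous_invol'.comp continuous_invol') continuous_id
    | ih f => rw [invol'_coe, invol'_coe, invol_invol]
  invol_comp {X Y Z} f g := by
    change Hom' X Y at f
    change Hom' Y Z at g
    change invol' (comp' f g) = comp' (invol' g) (invol' f)
    induction f, g using Completion.induction_on₂ with
    | hp =>
      exact isClosed_eq (continuous_invol'.comp (cont_comp continuous_fst continuous_snd))
        (cont_comp (continuous_invol'.comp continuous_snd)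
          (continuous_invol'.comp continuous_fst))
    | ih f g =>
      rw [invol'_coe, invol'_coe, coe_comp', coe_comp', invol'_coe, invol_comp]
  invol_add {X Y} f g := by
    change Hom' X Y at f g
    change invol' (f + g) = invol' f + invol' g
    induction f, g using Completion.induction_on₂ with
    | hp =>
      exact isClosed_eq (continuous_invol'.comp (continuous_fst.add continuous_snd))
        ((continuous_invol'.comp continuous_fst).add (continuous_invol'.comp continuous_snd))
    | ih f g =>
      rw [← Completion.coe_add, invol'_coe, invol'_coe, invol'_coe,
        LinearStarCategory.invol_add, Completion.coe_add]
  invol_smul {X Y} c f := by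
    change Hom' X Y at f
    change invol' (c • f) = (starRingEnd ℂ c) • invol' f
    induction f using Completion.induction_on with
    | hp =>
      exact isClosed_eq (continuous_invol'.comp (continuous_const_smul c))
        ((continuous_const_smul _).comp continuous_invol')
    | ih f =>
      rw [← Completion.coe_smul, invol'_coe, invol'_coe, LinearStarCategory.invol_smul,
        Completion.coe_smul]

variable (A) in
/-- The canonical morphism of `A` to its completion. -/
noncomputable def ι : LinStarFunctor A (Compl A) where
  obj a := ⟨a⟩
  map f := of f
  map_id _ := rfl
  map_comp f g := of_comp f g
  map_invol f := (invol'_coe (X := ⟨_⟩) (Y := ⟨_⟩) f).symm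
  map_add f g := Completion.coe_add f g
  map_smul c f := Completion.coe_smul c f

/-- The norm of the completion satisfies the `C^*`-identity. -/
theorem norm_comp_invol {X Y : Compl A} (f : Hom' X Y) : ‖f‖ * ‖f‖ = ‖comp' f (invol' f)‖ := by
  induction f using Completion.induction_on with
  | hp =>
    exact isClosed_eq (continuous_norm.mul continuous_norm)
      (continuous_norm.comp (cont_comp continuous_id continuous_invol'))
  | ih f =>
    rw [invol'_coe, coe_comp', Completion.norm_coe, Completion.norm_coe]
    refine le_antisymm (norm_sq_le f) ((norm_comp_le _ _).trans ?_)
    rw [norm_invol]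

theorem norm_comp_le' {X Y Z : Compl A} (f : Hom' X Y) (g : Hom' Y Z) :
    ‖comp' f g‖ ≤ ‖f‖ * ‖g‖ := by
  induction f, g using Completion.induction_on₂ with
  | hp =>
    exact isClosed_le (continuous_norm.comp (cont_comp continuous_fst continuous_snd))
      ((continuous_norm.comp continuous_fst).mul (continuous_norm.comp continuous_snd))
  | ih f g =>
    rw [coe_comp', Completion.norm_coe, Completion.norm_coe, Completion.norm_coe]
    exact norm_comp_le f g

/-- The endomorphisms of an object of the completion form a `C^*`-algebra. -/
noncomputable abbrev endCStar (X : Compl A) : NonUnitalCStarAlgebra (Hom' X X) :=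
  { (inferInstance : NormedAddCommGroup (Hom' X X)), (inferInstance : NormedSpace ℂ (Hom' X X)),
    (inferInstance : CompleteSpace (Hom' X X)) with
    mul := fun f g => comp' g f
    left_distrib := fun f g h => add_comp' g h f
    right_distrib := fun f g h => comp_add' h f g
    zero_mul := fun f => Limits.comp_zero (C := Compl A) (X := X) (Y := X) (f := f) (Z := X)
    mul_zero := fun f => Limits.zero_comp (C := Compl A) (X := X) (Y := X) (Z := X) (f := f)
    mul_assoc := fun f g h =>
      (Category.assoc (obj := Compl A) (W := X) (X := X) (Y := X) (Z := X) h g f).symm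
    norm_mul_le := fun f g => (norm_comp_le' g f).trans (le_of_eq (mul_comm _ _))
    star := invol'
    star_involutive := fun f => invol_invol (A := Compl A) (X := X) (Y := X) f
    star_mul := fun f g => invol_comp (A := Compl A) (X := X) (Y := X) (Z := X) g f
    star_add := fun f g => LinearStarCategory.invol_add (A := Compl A) (X := X) (Y := X) f g
    norm_mul_self_le := fun f => le_of_eq (norm_comp_invol f)
    smul_assoc := fun c f g => comp_smul' c g f
    smul_comm := fun c f g => (smul_comp' c g f).symm
    star_smul := fun c f => LinearStarCategory.invol_smul (A := Compl A) (X := X) (Y := X) c f }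

/-- Representations of the completion are contractive for the norm of the completion. -/
theorem rep_norm_le {B : Type (max u v)} [NonUnitalCStarAlgebra B] (σ : StarRep (Compl A) B)
    {X Y : Compl A} (f : Hom' X Y) : ‖σ.toFun (X := X) (Y := Y) f‖ ≤ ‖f‖ := by
  let _ := endCStar X
  let φ : Hom' X X →⋆ₙₐ[ℂ] B :=
    { toFun := σ.toFun (X := X) (Y := X)
      map_smul' := σ.map_smul (X := X) (Y := X)
      map_zero' := σ.map_zero X X
      map_add' := σ.map_add (X := X) (Y := X)
      map_mul' := fun f g => σ.map_comp (X := X) (Y := X) (Z := X) g f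
      map_star' := σ.map_invol (X := X) (Y := X) }
  have h := NonUnitalStarAlgHom.norm_apply_le φ (comp' f (invol' f))
  have h1 : φ (comp' f (invol' f)) =
      star (σ.toFun (X := X) (Y := Y) f) * σ.toFun (X := X) (Y := Y) f :=
    (σ.map_comp (X := X) (Y := Y) (Z := X) f (invol' f)).trans
      (congrArg (· * _) (σ.map_invol (X := X) (Y := Y) f))
  rw [h1, CStarRing.norm_star_mul_self] at h
  exact (mul_self_le_mul_self_iff (norm_nonneg _) (norm_nonneg _)).2 (h.trans (le_of_eq (norm_comp_invol f).symm))

theorem uniformContinuous_rep {B : Type (max u v)} [NonUnitalCStarAlgebra B] (ρ : StarRep A B)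
    (X Y : A) : UniformContinuous (ρ.toFun : (X ⟶ Y) → B) :=
  uniformContinuous_of_continuousAt_zero
    (AddMonoidHom.mk' (ρ.toFun : (X ⟶ Y) → B) ρ.map_add)
    ((AddMonoidHomClass.continuous_of_bound
      (AddMonoidHom.mk' (ρ.toFun : (X ⟶ Y) → B) ρ.map_add) 1
      (fun f => by simpa using norm_rep_le ρ f)).continuousAt)

/-- Representations of `A` extend to the completion. -/
noncomputable def extendRep {B : Type (max u v)} [NonUnitalCStarAlgebra B] (ρ : StarRep A B) :
    StarRep (Compl A) B where
  toFun {X Y} f := Completion.extension (ρ.toFun : (X.as ⟶ Y.as) → B) f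
  map_add {X Y} f g := by
    change Hom' X Y at f g
    change Completion.extension _ (f + g) = _
    induction f, g using Completion.induction_on₂ with
    | hp =>
      exact isClosed_eq (Completion.continuous_extension.comp (continuous_fst.add continuous_snd))
        ((Completion.continuous_extension.comp continuous_fst).add
          (Completion.continuous_extension.comp continuous_snd))
    | ih f g =>
      rw [← Completion.coe_add, Completion.extension_coe (uniformContinuous_rep ρ _ _),
        Completion.extension_coe (uniformContinuous_rep ρ _ _),
        Completion.extension_coe (uniformContinuous_rep ρ _ _), ρ.map_add]
  map_smul {X Y} c f := by
    change Hom' X Y at f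
    change Completion.extension _ (c • f) = _
    induction f using Completion.induction_on with
    | hp =>
      exact isClosed_eq (Completion.continuous_extension.comp (continuous_const_smul c))
        ((continuous_const_smul c).comp Completion.continuous_extension)
    | ih f =>
      rw [← Completion.coe_smul, Completion.extension_coe (uniformContinuous_rep ρ _ _),
        Completion.extension_coe (uniformContinuous_rep ρ _ _), ρ.map_smul]
  map_comp {X Y Z} f g := by
    change Hom' X Y at f
    change Hom' Y Z at g
    change Completion.extension _ (comp' f g) = _
    induction f, g using Completion.induction_on₂ with
    | hp =>
      exact isClosed_eq
        (Completion.continuous_extension.comp (cont_comp continuous_fst continuous_snd))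
        ((Completion.continuous_extension.comp continuous_snd).mul
          (Completion.continuous_extension.comp continuous_fst))
    | ih f g =>
      rw [coe_comp', Completion.extension_coe (uniformContinuous_rep ρ _ _),
        Completion.extension_coe (uniformContinuous_rep ρ _ _),
        Completion.extension_coe (uniformContinuous_rep ρ _ _), ρ.map_comp]
  map_invol {X Y} f := by
    change Hom' X Y at f
    change Completion.extension _ (invol' f) = _
    induction f using Completion.induction_on with
    | hp =>
      exact isClosed_eq (Completion.continuous_extension.comp continuous_invol')
        (Completion.continuous_extension.star)
    | ih f =>
      rw [invol'_coe, Completion.extension_coe (uniformContinuous_rep ρ _ _),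
        Completion.extension_coe (uniformContinuous_rep ρ _ _), ρ.map_invol]

theorem extendRep_of {B : Type (max u v)} [NonUnitalCStarAlgebra B] (ρ : StarRep A B)
    {X Y : Compl A} (f : X.as ⟶ Y.as) : (extendRep ρ).toFun (of f : X ⟶ Y) = ρ.toFun f :=
  Completion.extension_coe (uniformContinuous_rep ρ _ _) f

theorem maxNorm_le_norm {X Y : Compl A} (f : Hom' X Y) :
    maxNorm (A := Compl A) (X := X) (Y := Y) f ≤ ENNReal.ofReal ‖f‖ :=
  maxNorm_le fun B _ σ => by
    rw [← _root_.ofReal_norm]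
    exact ENNReal.ofReal_le_ofReal (rep_norm_le σ f)

/-- The maximal norm on the completion is the norm of the completion. -/
theorem maxNorm_eq {X Y : Compl A} (f : Hom' X Y) :
    maxNorm (A := Compl A) (X := X) (Y := Y) f = ENNReal.ofReal ‖f‖ := by
  refine le_antisymm (maxNorm_le_norm f) ?_
  refine ENNReal.le_of_forall_pos_le_add fun ε hε _ => ?_
  obtain ⟨g, hg⟩ := Metric.denseRange_iff.1
    (Completion.denseRange_coe (α := X.as ⟶ Y.as)) f (ε / 2) (by positivity)
  rw [dist_eq_norm] at hg
  have h1 : ENNReal.ofReal ‖(g : Hom' X Y)‖ ≤ maxNorm (of g : X ⟶ Y) := by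
    rw [Completion.norm_coe, ofReal_norm]
    refine maxNorm_le fun B _ ρ => ?_
    rw [← extendRep_of (X := X) (Y := Y)]
    exact enorm_le_maxNorm _ _
  have h2 : maxNorm (of g : X ⟶ Y) ≤
      maxNorm (A := Compl A) (X := X) (Y := Y) f + ENNReal.ofReal (ε / 2) := by
    have h3 : (of g : X ⟶ Y) = (show X ⟶ Y from f) + (show X ⟶ Y from (g : Hom' X Y) - f) :=
      (add_sub_cancel f (g : Hom' X Y)).symm
    rw [h3]
    refine (maxNorm_add_le _ _).trans (add_le_add le_rfl ((maxNorm_le_norm _).trans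
      (ENNReal.ofReal_le_ofReal ?_)))
    rw [norm_sub_rev]
    exact hg.le
  calc ENNReal.ofReal ‖f‖ ≤ ENNReal.ofReal (‖(g : Hom' X Y)‖ + ε / 2) := by
        refine ENNReal.ofReal_le_ofReal ?_
        have := norm_sub_norm_le f (g : Hom' X Y)
        linarith
    _ = ENNReal.ofReal ‖(g : Hom' X Y)‖ + ENNReal.ofReal (ε / 2) :=
        ENNReal.ofReal_add (norm_nonneg _) (by positivity)
    _ ≤ maxNorm (A := Compl A) (X := X) (Y := Y) f + ENNReal.ofReal (ε / 2) +
          ENNReal.ofReal (ε / 2) := add_le_add (h1.trans h2) le_rfl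
    _ = maxNorm (A := Compl A) (X := X) (Y := Y) f + ε := by
        rw [add_assoc, ← ENNReal.ofReal_add (by positivity) (by positivity), add_halves,
          ENNReal.ofReal_coe_nnreal]

/-- The completion of a pre-`C^*`-category is a `C^*`-category. -/
instance : IsCStar (Compl A) where
  maxNorm_ne_top f := ne_top_of_le_ne_top ENNReal.ofReal_ne_top (maxNorm_le_norm f)
  eq_zero {X Y} f hf := by
    change Hom' X Y at f
    rw [maxNorm_eq, ENNReal.ofReal_eq_zero] at hf
    exact norm_le_zero_iff.1 hf
  complete {X Y} s hs := by
    change ℕ → Hom' X Y at s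
    have hs' : CauchySeq s := Metric.cauchySeq_iff.2 fun ε hε => by
      obtain ⟨N, hN⟩ := hs (ENNReal.ofReal ε) (by simpa using hε)
      refine ⟨N, fun m hm n hn => ?_⟩
      have h := hN m hm n hn
      rw [dist_eq_norm]
      exact (ENNReal.ofReal_lt_ofReal_iff hε).1
        (lt_of_eq_of_lt (maxNorm_eq (s m - s n)).symm h)
    obtain ⟨f, hf⟩ := cauchySeq_tendsto_of_complete hs'
    refine ⟨f, ?_⟩
    have h := ENNReal.tendsto_ofReal (tendsto_iff_norm_sub_tendsto_zero.1 hf)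
    rw [ENNReal.ofReal_zero] at h
    exact h.congr fun n => (maxNorm_eq (s n - f)).symm

end Compl

end Completion

section Lift

open UniformSpace

variable {A : Type u} [Category.{v} A] [Preadditive A] [Linear ℂ A] [LinearStarCategory A]
  [IsPreCStar A]
variable {B : Type u} [Category.{v} B] [Preadditive B] [Linear ℂ B] [LinearStarCategory B]
  [IsCStar B]

instance homT0Space (X Y : B) : T0Space (X ⟶ Y) where
  t0 f g h := by
    rw [Metric.inseparable_iff, dist_eq_norm] at h
    refine sub_eq_zero.1 (IsCStar.eq_zero _ ?_)
    rw [← ofReal_norm, h, ENNReal.ofReal_zero]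

instance homCompleteSpace (X Y : B) : CompleteSpace (X ⟶ Y) :=
  Metric.complete_of_cauchySeq_tendsto fun s hs => by
    obtain ⟨f, hf⟩ := IsCStar.complete s fun ε hε => by
      by_cases h : ε = ∞
      · exact ⟨0, fun m _ n _ => by
          rw [h]
          exact lt_top_iff_ne_top.2 (IsPreCStar.maxNorm_ne_top _)⟩
      obtain ⟨N, hN⟩ := Metric.cauchySeq_iff.1 hs ε.toReal (ENNReal.toReal_pos hε.ne' h)
      refine ⟨N, fun m hm n hn => ?_⟩
      have h1 := hN m hm n hn
      rw [dist_eq_norm] at h1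
      rw [← ofReal_norm]
      exact (ENNReal.ofReal_lt_iff_lt_toReal (norm_nonneg _) h).2 h1
    refine ⟨f, tendsto_iff_norm_sub_tendsto_zero.2 ?_⟩
    have h := (ENNReal.tendsto_toReal ENNReal.zero_ne_top).comp hf
    rw [ENNReal.toReal_zero] at h
    exact h

theorem norm_map_le {C : Type u} [Category.{v} C] [Preadditive C] [Linear ℂ C]
    [LinearStarCategory C] [IsPreCStar C] (F : LinStarFunctor A C) {X Y : A} (f : X ⟶ Y) :
    ‖F.map f‖ ≤ ‖f‖ :=
  ENNReal.toReal_mono (IsPreCStar.maxNorm_ne_top _) (maxNorm_map_le F f)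

theorem uniformContinuous_map {C : Type u} [Category.{v} C] [Preadditive C] [Linear ℂ C]
    [LinearStarCategory C] [IsPreCStar C] (F : LinStarFunctor A C) (X Y : A) :
    UniformContinuous (F.map : (X ⟶ Y) → (F.obj X ⟶ F.obj Y)) :=
  uniformContinuous_of_continuousAt_zero
    (AddMonoidHom.mk' (F.map : (X ⟶ Y) → (F.obj X ⟶ F.obj Y)) F.map_add)
    ((AddMonoidHomClass.continuous_of_bound
      (AddMonoidHom.mk' (F.map : (X ⟶ Y) → (F.obj X ⟶ F.obj Y)) F.map_add) 1
      (fun f => by simpa using norm_map_le F f)).continuousAt)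

theorem continuous_invol (X Y : A) : Continuous fun f : X ⟶ Y => (invol f : Y ⟶ X) :=
  (Compl.uniformContinuous_invol X Y).continuous

namespace Compl

/-- The action of the extension of `F` to the completion on morphisms. -/
noncomputable def liftHom (F : LinStarFunctor A B) {X Y : Compl A} :
    Hom' X Y → (F.obj X.as ⟶ F.obj Y.as) :=
  Completion.extension (F.map : (X.as ⟶ Y.as) → (F.obj X.as ⟶ F.obj Y.as))

theorem continuous_liftHom (F : LinStarFunctor A B) {X Y : Compl A} :
    Continuous (liftHom F : Hom' X Y → _) := Completion.continuous_extension

theorem liftHom_coe (F : LinStarFunctor A B) {X Y : Compl A} (f : X.as ⟶ Y.as) :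
    liftHom F (f : Hom' X Y) = F.map f :=
  Completion.extension_coe (uniformContinuous_map F _ _) f

/-- A morphism to a `C^*`-category extends to the completion. -/
noncomputable def lift (F : LinStarFunctor A B) : LinStarFunctor (Compl A) B where
  obj X := F.obj X.as
  map f := liftHom F f
  map_id X := (liftHom_coe F (𝟙 X.as)).trans (F.map_id _)
  map_comp {X Y Z} f g := by
    change Hom' X Y at f
    change Hom' Y Z at g
    change liftHom F (comp' f g) = _
    induction f, g using Completion.induction_on₂ with
    | hp =>
      exact isClosed_eq ((continuous_liftHom F).comp (cont_comp continuous_fst continuous_snd))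
        ((continuous_comp' _ _ _).comp (((continuous_liftHom F).comp continuous_fst).prodMk
          ((continuous_liftHom F).comp continuous_snd)))
    | ih f g => rw [coe_comp', liftHom_coe, liftHom_coe, liftHom_coe, F.map_comp]
  map_invol {X Y} f := by
    change Hom' X Y at f
    change liftHom F (invol' f) = _
    induction f using Completion.induction_on with
    | hp =>
      exact isClosed_eq ((continuous_liftHom F).comp continuous_invol')
        ((continuous_invol _ _).comp (continuous_liftHom F))
    | ih f => rw [invol'_coe, liftHom_coe, liftHom_coe, F.map_invol]
  map_add {X Y} f g := by
    change Hom' X Y at f g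
    change liftHom F (f + g) = _
    induction f, g using Completion.induction_on₂ with
    | hp =>
      exact isClosed_eq ((continuous_liftHom F).comp (continuous_fst.add continuous_snd))
        (((continuous_liftHom F).comp continuous_fst).add
          ((continuous_liftHom F).comp continuous_snd))
    | ih f g =>
      rw [← Completion.coe_add, liftHom_coe, liftHom_coe, liftHom_coe, F.map_add]
  map_smul {X Y} c f := by
    change Hom' X Y at f
    change liftHom F (c • f) = _
    induction f using Completion.induction_on with
    | hp =>
      exact isClosed_eq ((continuous_liftHom F).comp (continuous_const_smul c))
        ((continuous_const_smul c).comp (continuous_liftHom F))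
    | ih f =>
      rw [← Completion.coe_smul, liftHom_coe, liftHom_coe, F.map_smul]

theorem lift_of (F : LinStarFunctor A B) {X Y : Compl A} (f : X.as ⟶ Y.as) :
    (lift F).map (of f : X ⟶ Y) = F.map f := liftHom_coe F f

/-- Morphisms of the completion to a `C^*`-category are continuous. -/
theorem continuous_map (F : LinStarFunctor (Compl A) B) (X Y : Compl A) :
    Continuous fun f : Hom' X Y => (F.map (X := X) (Y := Y) f : F.obj X ⟶ F.obj Y) :=
  AddMonoidHomClass.continuous_of_bound
    (AddMonoidHom.mk' (fun f : Hom' X Y => (F.map (X := X) (Y := Y) f : F.obj X ⟶ F.obj Y))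
      F.map_add) 1 fun f => by
    rw [one_mul]
    refine norm_le_of_maxNorm_le (norm_nonneg _) ?_
    rw [← maxNorm_eq]
    exact maxNorm_map_le F (X := X) (Y := Y) f

/-- Morphisms of the completion to a `C^*`-category are determined on `A`. -/
theorem functor_ext {F F' : LinStarFunctor (Compl A) B} (hobj : ∀ X, F.obj X = F'.obj X)
    (h : ∀ {X Y : Compl A} (f : X.as ⟶ Y.as),
      F.map (of f : X ⟶ Y) ≍ F'.map (of f : X ⟶ Y)) : F = F' := by
  have c (X Y : Compl A) := continuous_map F X Y
  have c' (X Y : Compl A) := continuous_map F' X Y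
  obtain ⟨⟨⟨o, m, _, _⟩, _⟩, ha, _⟩ := F
  obtain ⟨⟨⟨o', m', _, _⟩, _⟩, ha', _⟩ := F'
  obtain rfl : o = o' := funext hobj
  refine LinStarFunctor.ext_functor (CategoryTheory.Functor.hext (fun _ => rfl)
    fun X Y x => heq_of_eq ?_)
  change Hom' X Y at x
  induction x using Completion.induction_on with
  | hp => exact isClosed_eq (c X Y) (c' X Y)
  | ih f => exact eq_of_heq (h f)

/-- Morphisms of the completion of `A ⊗ 𝔾` to a `C^*`-category are determined on the objects and
on the morphisms `(φ, f)`. -/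
theorem tens_functor_ext {𝔾 : Grpd.{v, u}} {F F' : LinStarFunctor (Compl (LTens A 𝔾)) B}
    (hobj : ∀ X, F.obj X = F'.obj X)
    (h : ∀ {X Y : Compl (LTens A 𝔾)} (φ : X.as.snd ⟶ Y.as.snd) (f : X.as.fst ⟶ Y.as.fst),
      F.map (of (LTens.single φ f) : X ⟶ Y) ≍ F'.map (of (LTens.single φ f) : X ⟶ Y)) :
    F = F' := by
  refine functor_ext hobj ?_
  obtain ⟨⟨⟨o, m, _, _⟩, _⟩, ha, _⟩ := F
  obtain ⟨⟨⟨o', m', _, _⟩, _⟩, ha', _⟩ := F'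
  obtain rfl : o = o' := funext hobj
  intro X Y f
  refine heq_of_eq ?_
  induction f using LTens.induction with
  | h0 =>
    exact ((AddMonoidHom.mk' m ha).map_zero (M := X ⟶ Y)).trans
      ((AddMonoidHom.mk' m' ha').map_zero (M := X ⟶ Y)).symm
  | hadd x y hx hy =>
    have e : (of (x + y) : X ⟶ Y) = of x + of y := Completion.coe_add x y
    rw [e]
    exact (ha (of x) (of y)).trans ((congrArg₂ (· + ·) hx hy).trans (ha' (of x) (of y)).symm)
  | hs φ f => exact eq_of_heq (h φ f)

end Compl

end Lift

/-! ### The tensor structure of `C^*`-categories over groupoids -/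

/-- The composition of morphisms of `ℂ`-linear `*`-categories. -/
def LinStarFunctor.comp {A B C : Type u} [Category.{v} A] [Preadditive A] [Linear ℂ A]
    [LinearStarCategory A] [Category.{v} B] [Preadditive B] [Linear ℂ B] [LinearStarCategory B]
    [Category.{v} C] [Preadditive C] [Linear ℂ C] [LinearStarCategory C]
    (F : LinStarFunctor A B) (G : LinStarFunctor B C) : LinStarFunctor A C :=
  { F.toFunctor ⋙ G.toFunctor with
    map_invol := fun f => (congrArg G.map (F.map_invol f)).trans (G.map_invol _)
    map_add := fun f g => (congrArg G.map (F.map_add f g)).trans (G.map_add _ _)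
    map_smul := fun c f => (congrArg G.map (F.map_smul c f)).trans (G.map_smul _ _) }

section

variable {A : Type u} [Category.{v} A] [Preadditive A] [Linear ℂ A] [LinearStarCategory A]
  [IsCStar A]
variable {B : Type u} [Category.{v} B] [Preadditive B] [Linear ℂ B] [LinearStarCategory B]
  [IsCStar B]
variable {𝔾 ℍ : Grpd.{v, u}}

/-- The functoriality of the completion of `A ⊗ 𝔾`. -/
noncomputable def cstarMap (F : LinStarFunctor A B) (Φ : 𝔾 ⥤ ℍ) :
    LinStarFunctor (Compl (LTens A 𝔾)) (Compl (LTens B ℍ)) :=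
  Compl.lift ((LTens.map F Φ).comp (Compl.ι (LTens B ℍ)))

theorem cstarMap_of (F : LinStarFunctor A B) (Φ : 𝔾 ⥤ ℍ) {X Y : Compl (LTens A 𝔾)}
    (φ : X.as.snd ⟶ Y.as.snd) (f : X.as.fst ⟶ Y.as.fst) :
    (cstarMap F Φ).map (Compl.of (LTens.single φ f) : X ⟶ Y) =
      Compl.of (X := ⟨⟨F.obj X.as.fst, Φ.obj X.as.snd⟩⟩) (Y := ⟨⟨F.obj Y.as.fst, Φ.obj Y.as.snd⟩⟩)
        (LTens.single (Φ.map φ) (F.map f)) :=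
  (Compl.lift_of _ _).trans (congrArg Compl.of (LTens.mapHom_single F Φ φ f))

variable (A 𝔾) in
/-- The projection of the completion of `A ⊗ 𝔾` to `A`. -/
noncomputable def cstarProjFun : LinStarFunctor (Compl (LTens A 𝔾)) A :=
  Compl.lift (LTens.proj A 𝔾)

theorem cstarProjFun_of {X Y : Compl (LTens A 𝔾)}
    (φ : X.as.snd ⟶ Y.as.snd) (f : X.as.fst ⟶ Y.as.fst) :
    (cstarProjFun A 𝔾).map (Compl.of (LTens.single φ f) : X ⟶ Y) = f :=
  (Compl.lift_of _ _).trans (LTens.projHom_single φ f)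

end

/-- The tensor structure of `C^*`-categories over groupoids: the completion of `A ⊗ 𝔾` with
respect to the maximal norm. -/
noncomputable def cstarTensor : CStarCat.{v, u} × Grpd.{v, u} ⥤ CStarCat.{v, u} where
  obj P := ⟨{ carrier := Compl (LTens P.1.obj P.2) },
    inferInstanceAs (IsCStar (Compl (LTens P.1.obj P.2)))⟩
  map {P Q} F := ObjectProperty.homMk
    (cstarMap F.1.hom (show P.2.α ⥤ Q.2.α from F.2))
  map_id P := by
    ext1
    exact Compl.tens_functor_ext (B := Compl (LTens P.1.obj P.2)) (fun _ => rfl)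
      fun φ f => heq_of_eq (cstarMap_of (A := P.1.obj) (B := P.1.obj) _ _ φ f)
  map_comp {P Q R} F G := by
    ext1
    exact Compl.tens_functor_ext (B := Compl (LTens R.1.obj R.2)) (fun _ => rfl)
      fun φ f => heq_of_eq <| (cstarMap_of _ _ φ f).trans <| Eq.symm <|
        (congrArg (cstarMap G.1.hom (show Q.2.α ⥤ R.2.α from G.2)).map
          (cstarMap_of F.1.hom (show P.2.α ⥤ Q.2.α from F.2) φ f)).trans
        (cstarMap_of _ _ _ _)

/-- The projections from the completion of `A ⊗ 𝔾` to `A`. -/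
noncomputable def cstarProj : cstarTensor.{v, u} ⟶ CategoryTheory.Prod.fst _ _ where
  app P := ObjectProperty.homMk (cstarProjFun P.1.obj P.2)
  naturality P Q F := by
    ext1
    exact Compl.tens_functor_ext (B := Q.1.obj) (fun _ => rfl)
      fun φ f => heq_of_eq <|
        ((congrArg (cstarProjFun Q.1.obj Q.2).map
          (cstarMap_of F.1.hom (show P.2.α ⥤ Q.2.α from F.2) φ f)).trans
          (cstarProjFun_of _ _)).trans <| Eq.symm <|
        congrArg F.1.hom.map (cstarProjFun_of φ f)

/-! ### The tensor structures in the marked cases -/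

namespace Marked

variable {C : Type u₁} [Category.{v₁} C] {U : C ⥤ StarCat.{v, u}} (T : C × Grpd.{v, u} ⥤ C)
  (μ : ∀ (A : Marked U) (𝔾 : Grpd.{v, u}), Marking (U.obj (T.obj (A.obj, 𝔾))))

/-- Markings of the objects `A ♯ 𝔾` which are preserved by the morphisms `F ♯ Φ` extend a tensor
structure to marked objects. -/
def liftTensor (h : ∀ {P Q : Marked U × Grpd.{v, u}} (F : P ⟶ Q)
      {X Y : U.obj (T.obj (P.1.obj, P.2))} {f : X ⟶ Y}, (μ P.1 P.2).marked f →
      (μ Q.1 Q.2).marked ((U.map (T.map (X := (P.1.obj, P.2)) (Y := (Q.1.obj, Q.2))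
        (F.1.hom, F.2))).map f)) :
    Marked U × Grpd.{v, u} ⥤ Marked U where
  obj P := ⟨T.obj (P.1.obj, P.2), μ P.1 P.2⟩
  map F := ⟨T.map (F.1.hom, F.2), fun hf => h F hf⟩
  map_id P := hom_ext (T.map_id (P.1.obj, P.2))
  map_comp {P Q R} F G := hom_ext
    (T.map_comp (X := (P.1.obj, P.2)) (Y := (Q.1.obj, Q.2)) (Z := (R.1.obj, R.2))
      (F.1.hom, F.2) (G.1.hom, G.2))

/-- The extension of the projections `A ♯ 𝔾 ⟶ A` to marked objects. -/
def liftProj {T : C × Grpd.{v, u} ⥤ C}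
    {μ : ∀ (A : Marked U) (𝔾 : Grpd.{v, u}), Marking (U.obj (T.obj (A.obj, 𝔾)))}
    {h : ∀ {P Q : Marked U × Grpd.{v, u}} (F : P ⟶ Q)
      {X Y : U.obj (T.obj (P.1.obj, P.2))} {f : X ⟶ Y}, (μ P.1 P.2).marked f →
      (μ Q.1 Q.2).marked ((U.map (T.map (X := (P.1.obj, P.2)) (Y := (Q.1.obj, Q.2))
        (F.1.hom, F.2))).map f)}
    (π : T ⟶ CategoryTheory.Prod.fst C Grpd.{v, u})
    (hπ : ∀ {P : Marked U × Grpd.{v, u}} {X Y : U.obj (T.obj (P.1.obj, P.2))} {f : X ⟶ Y},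
      (μ P.1 P.2).marked f → P.1.marking.marked ((U.map (π.app (P.1.obj, P.2))).map f)) :
    liftTensor T μ h ⟶ CategoryTheory.Prod.fst (Marked U) Grpd.{v, u} where
  app P := ⟨π.app (P.1.obj, P.2), fun hf => hπ hf⟩
  naturality P Q F := hom_ext
    (π.naturality (X := (P.1.obj, P.2)) (Y := (Q.1.obj, Q.2)) (F.1.hom, F.2))

end Marked

/-- The marking of `A × 𝔾`: the morphisms `(f, φ)` with `f` marked. -/
def Marking.prod {A : Type u} [Category.{v} A] [StarCategory A] (M : Marking A)
    (𝔾 : Type u₁) [Groupoid.{v₁} 𝔾] : Marking (A × 𝔾) where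
  marked f := M.marked f.1
  isUnitary {X Y f} hf := by
    refine ⟨Prod.ext (M.isUnitary hf).1 (Groupoid.comp_inv f.2),
      Prod.ext (M.isUnitary hf).2 (Groupoid.inv_comp f.2)⟩
  id_mem X := M.id_mem X.1
  comp_mem hf hg := M.comp_mem hf hg
  invol_mem hf := M.invol_mem hf

/-- The marking of `A ⊗ 𝔾`: the morphisms `(φ, f)` with `f` marked. -/
def Marking.tens {A : Type u} [Category.{v} A] [Preadditive A] [Linear ℂ A]
    [LinearStarCategory A] (M : Marking A) (𝔾 : Type u₁) [Groupoid.{v₁} 𝔾] :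
    Marking (LTens A 𝔾) where
  marked {X Y} m := ∃ (φ : X.snd ⟶ Y.snd) (f : X.fst ⟶ Y.fst), M.marked f ∧ m = LTens.single φ f
  isUnitary := by
    rintro X Y _ ⟨φ, f, hf, rfl⟩
    exact LTens.isUnitary_single φ (M.isUnitary hf)
  id_mem X := ⟨𝟙 X.snd, 𝟙 X.fst, M.id_mem _, rfl⟩
  comp_mem := by
    rintro X Y Z _ _ ⟨φ, f, hf, rfl⟩ ⟨ψ, g, hg, rfl⟩
    exact ⟨φ ≫ ψ, f ≫ g, M.comp_mem hf hg, LTens.single_comp _ _ _ _⟩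
  invol_mem := by
    rintro X Y _ ⟨φ, f, hf, rfl⟩
    exact ⟨Groupoid.inv φ, invol f, M.invol_mem hf, LTens.invol_single _ _⟩

/-- The marking of the completion of `A`: the images of the marked morphisms of `A`. -/
def Marking.compl {A : Type u} [Category.{v} A] [Preadditive A] [Linear ℂ A]
    [LinearStarCategory A] [IsPreCStar A] (M : Marking A) : Marking (Compl A) where
  marked {X Y} m := ∃ f : X.as ⟶ Y.as, M.marked f ∧ m = Compl.of f
  isUnitary := by
    rintro X Y _ ⟨f, hf, rfl⟩
    have h := (Compl.ι A).map_invol f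
    constructor
    · refine (congrArg (fun k => (Compl.of f : X ⟶ Y) ≫ k) h.symm).trans ?_
      exact (Compl.of_comp (X := X) (Y := Y) (Z := X) f (invol f)).symm.trans
        (congrArg (Compl.of (X := X) (Y := X)) (M.isUnitary hf).1)
    · refine (congrArg (fun k => k ≫ (Compl.of f : X ⟶ Y)) h.symm).trans ?_
      exact (Compl.of_comp (X := Y) (Y := X) (Z := Y) (invol f) f).symm.trans
        (congrArg (Compl.of (X := Y) (Y := Y)) (M.isUnitary hf).2)
  id_mem X := ⟨𝟙 X.as, M.id_mem _, rfl⟩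
  comp_mem := by
    rintro X Y Z _ _ ⟨f, hf, rfl⟩ ⟨g, hg, rfl⟩
    exact ⟨f ≫ g, M.comp_mem hf hg, (Compl.of_comp _ _).symm⟩
  invol_mem := by
    rintro X Y _ ⟨f, hf, rfl⟩
    exact ⟨invol f, M.invol_mem hf, ((Compl.ι A).map_invol f).symm⟩

theorem markedStarTensor_map {P Q : MarkedStarCat.{v, u} × Grpd.{v, u}} (F : P ⟶ Q)
    {X Y : starTensor.obj (P.1.obj, P.2)} {f : X ⟶ Y} (hf : (P.1.marking.prod P.2).marked f) :
    (Q.1.marking.prod Q.2).marked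
      ((starTensor.map (X := (P.1.obj, P.2)) (Y := (Q.1.obj, Q.2)) (F.1.hom, F.2)).map f) :=
  F.1.map_marked hf

/-- The tensor structure of marked `*`-categories over groupoids. -/
def markedStarTensor : MarkedStarCat.{v, u} × Grpd.{v, u} ⥤ MarkedStarCat.{v, u} :=
  Marked.liftTensor starTensor (fun A 𝔾 => A.marking.prod 𝔾) markedStarTensor_map

/-- The projections `A × 𝔾 ⟶ A`. -/
def markedStarProj : markedStarTensor.{v, u} ⟶ CategoryTheory.Prod.fst _ _ :=
  Marked.liftProj (h := markedStarTensor_map) starProj fun hf => hf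

/-- The marking of `A ⊗ 𝔾` for a marked `ℂ`-linear `*`-category `A`. -/
def linMarking (A : MarkedLinStarCat.{v, u}) (𝔾 : Grpd.{v, u}) : Marking (LTens A.obj 𝔾) :=
  (show Marking A.obj from A.marking).tens 𝔾

theorem markedLinTensor_map {P Q : MarkedLinStarCat.{v, u} × Grpd.{v, u}} (F : P ⟶ Q)
    {X Y : LTens P.1.obj P.2} {f : X ⟶ Y} (hf : (linMarking P.1 P.2).marked f) :
    (linMarking Q.1 Q.2).marked ((LTens.map F.1.hom (show P.2.α ⥤ Q.2.α from F.2)).map f) := by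
  obtain ⟨φ, f, hf, rfl⟩ := hf
  exact ⟨_, _, F.1.map_marked hf,
    LTens.mapHom_single F.1.hom (show P.2.α ⥤ Q.2.α from F.2) φ f⟩

/-- The tensor structure of marked `ℂ`-linear `*`-categories over groupoids. -/
noncomputable def markedLinTensor :
    MarkedLinStarCat.{v, u} × Grpd.{v, u} ⥤ MarkedLinStarCat.{v, u} :=
  Marked.liftTensor linTensor linMarking markedLinTensor_map

/-- The projections `A ⊗ 𝔾 ⟶ A`. -/
noncomputable def markedLinProj : markedLinTensor.{v, u} ⟶ CategoryTheory.Prod.fst _ _ :=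
  Marked.liftProj (h := markedLinTensor_map) linProj <| by
    rintro P X Y _ ⟨φ, f, hf, rfl⟩
    have e : (LTens.proj P.1.obj P.2).map (LTens.single φ f : X ⟶ Y) = f :=
      LTens.projHom_single φ f
    exact e.symm ▸ hf

/-- The marking of the completion of `A ⊗ 𝔾` for a marked `C^*`-category `A`: the images of the
morphisms `(φ, f)` with `f` marked. -/
noncomputable def cstarMarking (A : MarkedCStarCat.{v, u}) (𝔾 : Grpd.{v, u}) :
    Marking (Compl (LTens A.obj.obj 𝔾)) :=
  ((show Marking A.obj.obj from A.marking).tens 𝔾).compl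

theorem markedCStarTensor_map {P Q : MarkedCStarCat.{v, u} × Grpd.{v, u}} (F : P ⟶ Q)
    {X Y : Compl (LTens P.1.obj.obj P.2)} {f : X ⟶ Y} (hf : (cstarMarking P.1 P.2).marked f) :
    (cstarMarking Q.1 Q.2).marked
      ((cstarMap F.1.hom.hom (show P.2.α ⥤ Q.2.α from F.2)).map f) := by
  obtain ⟨_, ⟨φ, f, hf, rfl⟩, rfl⟩ := hf
  exact ⟨_, ⟨_, _, F.1.map_marked hf, rfl⟩,
    cstarMap_of F.1.hom.hom (show P.2.α ⥤ Q.2.α from F.2) φ f⟩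

/-- The tensor structure of marked `C^*`-categories over groupoids. -/
noncomputable def markedCStarTensor :
    MarkedCStarCat.{v, u} × Grpd.{v, u} ⥤ MarkedCStarCat.{v, u} :=
  Marked.liftTensor cstarTensor cstarMarking markedCStarTensor_map

/-- The projections from the completion of `A ⊗ 𝔾` to `A`. -/
noncomputable def markedCStarProj : markedCStarTensor.{v, u} ⟶ CategoryTheory.Prod.fst _ _ :=
  Marked.liftProj (h := markedCStarTensor_map) cstarProj <| by
    rintro P X Y _ ⟨_, ⟨φ, f, hf, rfl⟩, rfl⟩
    have e : (cstarProjFun P.1.obj.obj P.2).map (Compl.of (LTens.single φ f) : X ⟶ Y) = f :=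
      cstarProjFun_of φ f
    exact e.symm ▸ hf

/-! ### Initial objects -/

/-- The empty set of objects. -/
inductive EmptyObj : Type u

instance : Category.{v} EmptyObj.{u} where
  Hom x := nomatch x
  id x := nomatch x
  comp {x} := nomatch x
  id_comp {x} := nomatch x
  comp_id {x} := nomatch x
  assoc {x} := nomatch x

instance : Preadditive EmptyObj.{u} where
  homGroup x := nomatch x
  add_comp x := nomatch x
  comp_add x := nomatch x

instance : Linear ℂ EmptyObj.{u} where
  homModule x := nomatch x
  smul_comp x := nomatch x
  comp_smul x := nomatch x

instance : LinearStarCategory EmptyObj.{u} where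
  invol {x} := nomatch x
  invol_invol {x} := nomatch x
  invol_comp {x} := nomatch x
  invol_add {x} := nomatch x
  invol_smul {x} := nomatch x

/-- The empty `ℂ`-linear `*`-category. -/
def emptyLin : LinStarCat.{v, u} where
  carrier := EmptyObj.{u}

theorem isCStar_emptyLin : LinStarCat.isCStar emptyLin.{v, u} :=
  { maxNorm_ne_top := fun {x : EmptyObj} => nomatch x
    eq_zero := fun {x : EmptyObj} => nomatch x
    complete := fun {x : EmptyObj} => nomatch x }

/-- The empty marking. -/
def emptyMarking : Marking (LinStarCat.forget.obj emptyLin.{v, u}) where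
  marked {x : EmptyObj} := nomatch x
  isUnitary {x : EmptyObj} := nomatch x
  id_mem (x : EmptyObj) := nomatch x
  comp_mem {x : EmptyObj} := nomatch x
  invol_mem {x : EmptyObj} := nomatch x

/-- The morphisms out of the empty category. -/
def fromEmpty (A : LinStarCat.{v, u}) : emptyLin.{v, u} ⟶ A :=
  ({ obj := fun x : EmptyObj => nomatch x
     map := fun {x : EmptyObj} => nomatch x
     map_id := fun x : EmptyObj => nomatch x
     map_comp := fun {x : EmptyObj} => nomatch x
     map_invol := fun {x : EmptyObj} => nomatch x
     map_add := fun {x : EmptyObj} => nomatch x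
     map_smul := fun {x : EmptyObj} => nomatch x } : LinStarFunctor emptyLin A)

/-- The morphisms out of the empty category, for `*`-categories. -/
def fromEmptyStar (A : StarCat.{v, u}) : LinStarCat.forget.obj emptyLin.{v, u} ⟶ A :=
  ({ obj := fun x : EmptyObj => nomatch x
     map := fun {x : EmptyObj} => nomatch x
     map_id := fun x : EmptyObj => nomatch x
     map_comp := fun {x : EmptyObj} => nomatch x
     map_invol := fun {x : EmptyObj} => nomatch x } :
    StarFunctor (LinStarCat.forget.obj emptyLin) A)

theorem fromEmpty_star_unique {A : StarCat.{v, u}}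
    (F G : LinStarCat.forget.obj emptyLin.{v, u} ⟶ A) : F = G :=
  StarFunctor.ext_functor
    (CategoryTheory.Functor.hext (fun x : EmptyObj => nomatch x) fun x : EmptyObj => nomatch x)

theorem fromEmpty_unique {A : LinStarCat.{v, u}} (F G : emptyLin.{v, u} ⟶ A) : F = G :=
  LinStarFunctor.ext_functor
    (CategoryTheory.Functor.hext (fun x : EmptyObj => nomatch x) fun x : EmptyObj => nomatch x)

instance : Limits.HasInitial StarCat.{v, u} :=
  (Limits.IsInitial.ofUniqueHom (X := LinStarCat.forget.obj emptyLin) fromEmptyStar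
    fun _ _ => fromEmpty_star_unique _ _).hasInitial

instance : Limits.HasInitial LinStarCat.{v, u} :=
  (Limits.IsInitial.ofUniqueHom (X := emptyLin) fromEmpty
    fun _ _ => fromEmpty_unique _ _).hasInitial

instance : Limits.HasInitial CStarCat.{v, u} :=
  (Limits.IsInitial.ofUniqueHom (X := (⟨emptyLin, isCStar_emptyLin⟩ : CStarCat.{v, u}))
    (fun A => ObjectProperty.homMk (fromEmpty A.obj))
    fun _ _ => ObjectProperty.hom_ext _ (fromEmpty_unique _ _)).hasInitial

instance : Limits.HasInitial MarkedStarCat.{v, u} :=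
  (Limits.IsInitial.ofUniqueHom
    (X := (⟨LinStarCat.forget.obj emptyLin, emptyMarking⟩ : MarkedStarCat.{v, u}))
    (fun A => Marked.Hom.mk (fromEmptyStar A.obj) fun {x : EmptyObj} => nomatch x)
    fun _ _ => Marked.hom_ext (fromEmpty_star_unique _ _)).hasInitial

instance : Limits.HasInitial MarkedLinStarCat.{v, u} :=
  (Limits.IsInitial.ofUniqueHom (X := (⟨emptyLin, emptyMarking⟩ : MarkedLinStarCat.{v, u}))
    (fun A => Marked.Hom.mk (fromEmpty A.obj) fun {x : EmptyObj} => nomatch x)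
    fun _ _ => Marked.hom_ext (fromEmpty_unique _ _)).hasInitial

instance : Limits.HasInitial MarkedCStarCat.{v, u} :=
  (Limits.IsInitial.ofUniqueHom
    (X := (⟨⟨emptyLin, isCStar_emptyLin⟩, emptyMarking⟩ : MarkedCStarCat.{v, u}))
    (fun A => Marked.Hom.mk (ObjectProperty.homMk (fromEmpty A.obj.obj)) fun {x : EmptyObj} => nomatch x)
    fun _ _ => Marked.hom_ext (ObjectProperty.hom_ext _ (fromEmpty_unique _ _))).hasInitial

end StarCats

namespace StarCats

open StarCategory

/-! ### Twisting and lifting morphisms of `*`-categories -/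

/-! Weak equivalence. For a contractible groupoid `S̃` on a set `S` and `s` in `S`, the inclusion `i
: A ⟶ A ♯ S̃`, `a ↦ (a, s)`, `f ↦ (f, id)`, is a section of the projection `π : A ♯ S̃ ⟶ A`. In the
other direction, the morphisms `(id, s → t) : (a, s) ⟶ (a, t)` are unitary, and marked in the marked
cases, and they form an isomorphism from `π ≫ i` to the identity. For `S = G` and `s = 1` this
inverts the components of `ε`. The inverse need not be `G`-equivariant, because projective weak
equivalences are tested on underlying morphisms.

Cofibrancy. Let `f : E ⟶ B` be a projective trivial fibration and `u : D ⟶ B` an equivariant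
morphism, where the objects of `D` carry a `G`-equivariant map `t` to `G`; for `D' ♯ G̃` this is the
second coordinate. The underlying morphism of `f` is fully faithful, reflects marked morphisms and
is surjective on objects. Surjectivity gives arbitrary preimages `e y` of the objects `u y`, and
freeness of the action makes the choice equivariant: `x ↦ t x · e ((t x)⁻¹ x)`. Full faithfulness
then produces exactly one lift of `u` with these objects. It respects all structure that `f`
detects, and its uniqueness forces it to be equivariant.

Surjectivity is where fibrations enter, which are known only through their lifting property
(`surjective_of_trivialFibration`). Given `b` in `B` and an inverse `g` of `f` up to marked
isomorphism, take the two-point cylinder `E ♯ S̃` and change `π ≫ f` at the single object `(g b,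
true)`, conjugating by the given isomorphism `f (g b) ≅ b` so that this object goes to `b`. On the
end `false` nothing changes, the inclusion of that end is a trivial cofibration, and a lift sends
`(g b, true)` to a preimage of `b`.

All six cases run through one abstract statement, `IsMarkedStarSetting.isCofibrantReplacement`,
about a functor `W` to `*`-categories with a marking on each value; unmarked categories carry the
marking by all unitaries. Its inputs are that structure lifts along suitable faithful morphisms,
that conjugation by marked morphisms stays in the category, and that the cylinders above exist. -/

/-- The marking by all unitary morphisms. -/
def unitaryMarking (A : Type u) [Category.{v} A] [StarCategory A] : Marking A where
  marked f := IsUnitary f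
  isUnitary hf := hf
  id_mem X := by simp [IsUnitary]
  comp_mem {X Y Z f g} hf hg := by
    constructor
    · rw [invol_comp, Category.assoc, reassoc_of% hg.1, hf.1]
    · rw [invol_comp, Category.assoc, reassoc_of% hf.2, hg.2]
  invol_mem hf := by
    refine ⟨?_, ?_⟩
    · rw [invol_invol]; exact hf.2
    · rw [invol_invol]; exact hf.1

theorem IsUnitary.map {A : Type u} [Category.{v} A] [StarCategory A]
    {B : Type u₁} [Category.{v₁} B] [StarCategory B] (F : StarFunctor A B) {X Y : A} {f : X ⟶ Y}
    (hf : IsUnitary f) : IsUnitary (F.map f) := by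
  constructor
  · rw [← F.map_invol, ← F.map_comp, hf.1, F.map_id]
  · rw [← F.map_invol, ← F.map_comp, hf.2, F.map_id]

/-- Modify the object function of a morphism of `*`-categories along unitary morphisms. -/
def StarFunctor.twist {A : Type u} [Category.{v} A] [StarCategory A]
    {B : Type u₁} [Category.{v₁} B] [StarCategory B] (F : StarFunctor A B) (o : A → B)
    (w : ∀ a, F.obj a ⟶ o a) (hw : ∀ a, IsUnitary (w a)) : StarFunctor A B where
  obj := o
  map f := invol (w _) ≫ F.map f ≫ w _
  map_id X := by simp [(hw X).2]
  map_comp {X Y Z} f g := by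
    simp only [F.map_comp, Category.assoc, reassoc_of% (hw Y).1]
  map_invol f := by simp [F.map_invol]

/-- The twisted morphism is isomorphic to the original one. -/
def StarFunctor.twistIso {A : Type u} [Category.{v} A] [StarCategory A]
    {B : Type u₁} [Category.{v₁} B] [StarCategory B] (F : StarFunctor A B) (o : A → B)
    (w : ∀ a, F.obj a ⟶ o a) (hw : ∀ a, IsUnitary (w a)) :
    F.toFunctor ≅ (F.twist o w hw).toFunctor :=
  NatIso.ofComponents (fun a => ⟨w a, invol (w a), (hw a).1, (hw a).2⟩) fun {X Y} f => by
    change F.map f ≫ w Y = w X ≫ invol (w X) ≫ F.map f ≫ w Y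
    rw [reassoc_of% (hw X).1]

/-- Naturality of `w` amounts to the conjugate of `F` by `w` being `G`. Phrased as an equality of
morphisms, it can be checked by the extensionality principles for `A ⊗ 𝔾` and its completion, hence
only on the generators `(φ, f)`, with no separate linearity or density argument. -/
theorem markedlyIsomorphic_of_twist_eq {A B : StarCat.{v, u}} (M : Marking B) {F G : A ⟶ B}
    (w : ∀ a, F.obj a ⟶ G.obj a) (hw : ∀ a, M.marked (w a))
    (h : StarFunctor.twist F G.obj w (fun a => M.isUnitary (hw a)) = G) :
    MarkedlyIsomorphic M F G := by
  have key : ∀ (o : A → B) (w : ∀ a, F.obj a ⟶ o a) (hw : ∀ a, M.marked (w a)),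
      MarkedlyIsomorphic M F
        (StarFunctor.twist F o w (fun a => M.isUnitary (hw a)) : StarFunctor A B) :=
    fun o w hw => ⟨StarFunctor.twistIso F o w _, hw⟩
  have := key G.obj w hw
  rwa [h] at this

/-- Twisting does not change the restriction to a subcategory on which the twisting morphisms are
identities. -/
theorem comp_twist {A X B : StarCat.{v, u}} (I : A ⟶ X) (K : X ⟶ B)
    (p : ∀ x : X, Σ b : B, (K.obj x ⟶ b)) (hp : ∀ x, IsUnitary (p x).2)
    (h : ∀ a : A, p (I.obj a) = ⟨K.obj (I.obj a), 𝟙 _⟩) :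
    I ≫ (show X ⟶ B from StarFunctor.twist K (fun x => (p x).1) (fun x => (p x).2) hp) =
      I ≫ K := by
  -- Target object and twisting morphism are bundled in a sigma type, so that being trivial at an
  -- object is a single equation. Destructing it removes every transport from the heterogeneous
  -- equality.
  have key : ∀ {b b' : B} (f : b ⟶ b') (q : Σ c : B, (b ⟶ c)) (q' : Σ c : B, (b' ⟶ c)),
      q = ⟨b, 𝟙 b⟩ → q' = ⟨b', 𝟙 b'⟩ → invol q.2 ≫ f ≫ q'.2 ≍ f := by
    rintro b b' f _ _ rfl rfl
    simp
  exact StarFunctor.ext_functor (CategoryTheory.Functor.hext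
    (fun a => congrArg Sigma.fst (h a)) fun a a' f => key _ _ _ (h a) (h a'))

/-- Lifts along a fully faithful morphism of `*`-categories exist if they exist on objects. -/
theorem exists_lift_of_fullyFaithful {A E B : StarCat.{v, u}} (F : E ⟶ B)
    (hF : F.toFunctor.FullyFaithful) (k : A ⟶ B) (o : A → E)
    (ho : ∀ a, F.obj (o a) = k.obj a) : ∃ l : A ⟶ E, l.obj = o ∧ l ≫ F = k := by
  obtain ⟨⟨ko, km, kid, kcomp⟩, kinv⟩ := k
  -- Once the object function of `k` is literally `F ∘ o`, preimages under `F` typecheck without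
  -- `eqToHom`. Each axiom for the lift is then tested after applying the faithful `F`.
  obtain rfl : (fun a => F.obj (o a)) = ko := funext ho
  refine ⟨({ obj := o
             map := fun f => hF.preimage (km f)
             map_id := fun a => hF.map_injective ?_
             map_comp := fun f g => hF.map_injective ?_
             map_invol := fun f => hF.map_injective ?_ } : StarFunctor A E), rfl, ?_⟩
  · exact (hF.map_preimage _).trans ((kid a).trans (F.map_id _).symm)
  · rw [F.map_comp]
    refine (hF.map_preimage _).trans ((kcomp f g).trans ?_)
    exact (congrArg₂ (· ≫ ·) (hF.map_preimage _) (hF.map_preimage _)).symm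
  · refine (hF.map_preimage _).trans ((kinv f).trans ?_)
    exact ((F.map_invol _).trans (congrArg invol (hF.map_preimage _))).symm
  · exact StarFunctor.ext_functor (CategoryTheory.Functor.hext (fun _ => rfl)
      fun _ _ f => heq_of_eq (hF.map_preimage _))

/-- Lifts along a faithful morphism of `*`-categories are determined on objects. -/
theorem lift_unique_of_faithful {A E B : StarCat.{v, u}} (F : E ⟶ B)
    (hF : F.toFunctor.Faithful) (k l : A ⟶ E) (ho : k.obj = l.obj) (h : k ≫ F = l ≫ F) :
    k = l := by
  obtain ⟨⟨ko, km, kid, kcomp⟩, kinv⟩ := k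
  obtain ⟨⟨lo, lm, lid, lcomp⟩, linv⟩ := l
  obtain rfl : ko = lo := ho
  refine StarFunctor.ext_functor (CategoryTheory.Functor.hext (fun _ => rfl)
    fun X Y f => heq_of_eq (hF.map_injective ?_))
  have := congrArg StarFunctor.toFunctor h
  have e := Functor.congr_hom this f
  simp only [eqToHom_refl, Category.comp_id, Category.id_comp] at e
  exact e

/-! ### Equivalences -/

/-- A morphism with an inverse up to marked isomorphism is fully faithful. -/
theorem fullyFaithful_of_markedlyIsomorphic {A B : StarCat.{v, u}} {M : Marking A}
    {N : Marking B} {f : A ⟶ B} {g : B ⟶ A} (h₁ : MarkedlyIsomorphic M (f ≫ g) (𝟙 A))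
    (h₂ : MarkedlyIsomorphic N (g ≫ f) (𝟙 B)) : Nonempty f.toFunctor.FullyFaithful := by
  obtain ⟨e₁, -⟩ := h₁
  obtain ⟨e₂, -⟩ := h₂
  let e : A.carrier ≌ B.carrier :=
    CategoryTheory.Equivalence.mk f.toFunctor g.toFunctor e₁.symm e₂
  exact ⟨e.fullyFaithfulFunctor⟩

/-- Naturality exhibits `m` as the conjugate of `k.map m` by the marked components of the
isomorphism. Applied to a composite of an equivalence with its inverse, this shows that equivalences
reflect marked morphisms. -/
theorem marked_of_markedlyIsomorphic {A : StarCat.{v, u}} {M : Marking A} {k : A ⟶ A}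
    (h : MarkedlyIsomorphic M k (𝟙 A)) {X Y : A} {m : X ⟶ Y} (hm : M.marked (k.map m)) :
    M.marked m := by
  obtain ⟨e, he⟩ := h
  have hn : k.map m ≫ e.hom.app Y = e.hom.app X ≫ m := e.hom.naturality m
  have h1 : invol (e.hom.app X) ≫ k.map m ≫ e.hom.app Y = m :=
    (congrArg (fun t => invol (e.hom.app X) ≫ t) hn).trans
      ((Category.assoc _ _ _).symm.trans ((congrArg (fun t => t ≫ m)
        (M.isUnitary (he X)).2).trans (Category.id_comp m)))
  rw [← h1]
  exact M.comp_mem (M.invol_mem (he X)) (M.comp_mem hm (he Y))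

/-! ### An abstract setting covering the marked and the unmarked categories -/

section Setting

variable {C : Type u₁} [Category.{v₁} C]

/-- The equivalences of a category of `*`-categories with respect to a choice of markings. -/
def markingEquivalences (W : C ⥤ StarCat.{v, u}) (M : ∀ A, Marking (W.obj A)) :
    MorphismProperty C := fun A B f =>
  ∃ g : B ⟶ A, MarkedlyIsomorphic (M A) (W.map (f ≫ g)) (W.map (𝟙 A)) ∧
    MarkedlyIsomorphic (M B) (W.map (g ≫ f)) (W.map (𝟙 B))

/-- A category of `*`-categories with additional structure and markings, in which lifts along
fully faithful morphisms which reflect markings and twists by marked morphisms exist, and whose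
weak equivalences, cofibrations and fibrations are the standard ones. -/
structure IsMarkedStarSetting [CategoryWithWeakEquivalences C] [CategoryWithCofibrations C]
    [CategoryWithFibrations C] (W : C ⥤ StarCat.{v, u}) (M : ∀ A, Marking (W.obj A)) : Prop where
  map_marked {A B : C} (f : A ⟶ B) {X Y : W.obj A} {m : X ⟶ Y} :
    (M A).marked m → (M B).marked ((W.map f).map m)
  injective {A B : C} (f g : A ⟶ B) : W.map f = W.map g → f = g
  -- Faithfulness of `f` forces the lift `k` to be linear, since its composite with `f` is.
  -- Reflection of marked morphisms forces `k` to preserve them.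
  lift {A E B : C} (f : E ⟶ B) (u : A ⟶ B) (k : W.obj A ⟶ W.obj E)
    (hf : (W.map f).toFunctor.Faithful)
    (hf' : ∀ {X Y : W.obj E} {m : X ⟶ Y}, (M B).marked ((W.map f).map m) → (M E).marked m)
    (hk : k ≫ W.map f = W.map u) : ∃ l : A ⟶ E, W.map l = k
  twist {A B : C} (f : A ⟶ B) (o : W.obj A → W.obj B) (w : ∀ a, (W.map f).obj a ⟶ o a)
    (hw : ∀ a, (M B).marked (w a)) :
    ∃ g : A ⟶ B, W.map g = StarFunctor.twist (W.map f) o w fun a => (M B).isUnitary (hw a)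
  weakEquivalences_eq : weakEquivalences C = markingEquivalences W M
  cofibrations_eq : cofibrations C = injectiveOnObjects W
  fibrations_eq : fibrations C = (trivialCofibrations C).rlp

/-- Cylinders: a tensor structure over groupoids with the inclusions of the objects of contractible
groupoids. -/
structure HasTildeCylinders (W : C ⥤ StarCat.{v, u}) (M : ∀ A, Marking (W.obj A))
    (T : C × Grpd.{v, u} ⥤ C) (π : T ⟶ CategoryTheory.Prod.fst C Grpd.{v, u})
    (p : ∀ (A : C) (𝔾 : Grpd.{v, u}), W.obj (T.obj (A, 𝔾)) → 𝔾) : Prop where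
  -- `p` is the groupoid coordinate of an object. Its naturality yields the equivariant map to `G`;
  -- `exists_obj` supplies objects off the image of an end inclusion; `exists_incl` supplies the
  -- inverse of `π`.
  map_obj {A B : C} {𝔾 ℍ : Grpd.{v, u}} (f : A ⟶ B) (φ : 𝔾 ⟶ ℍ) (x : W.obj (T.obj (A, 𝔾))) :
    p B ℍ ((W.map (T.map (X := (A, 𝔾)) (Y := (B, ℍ)) (f, φ))).obj x) =
      (show 𝔾.α ⥤ ℍ.α from φ).obj (p A 𝔾 x)
  exists_obj (A : C) (𝔾 : Grpd.{v, u}) (a : W.obj A) (s : 𝔾) :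
    ∃ x, (W.map (π.app (A, 𝔾))).obj x = a ∧ p A 𝔾 x = s
  exists_incl (A : C) (S : Type u) (s : S) :
    ∃ i : A ⟶ T.obj (A, tildeGrpd S), i ≫ π.app (A, tildeGrpd S) = 𝟙 A ∧
      (∀ a, p A (tildeGrpd S) ((W.map i).obj a) = s) ∧
      MarkedlyIsomorphic (M _) (W.map (π.app (A, tildeGrpd S) ≫ i)) (W.map (𝟙 _))

theorem markedlyIsomorphic_refl {A B : StarCat.{v, u}} (M : Marking B) (f : A ⟶ B) :
    MarkedlyIsomorphic M f f :=
  ⟨Iso.refl _, fun a => M.id_mem (f.obj a)⟩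

section

variable {W : C ⥤ StarCat.{v, u}} {M : ∀ A, Marking (W.obj A)}

theorem markingEquivalences.comp_map {A B : C} {f : A ⟶ B} (hf : markingEquivalences W M f) :
    ∃ g : B ⟶ A, MarkedlyIsomorphic (M A) (W.map f ≫ W.map g) (𝟙 _) ∧
      MarkedlyIsomorphic (M B) (W.map g ≫ W.map f) (𝟙 _) := by
  obtain ⟨g, h₁, h₂⟩ := hf
  rw [W.map_comp, W.map_id] at h₁ h₂
  exact ⟨g, h₁, h₂⟩

theorem markingEquivalences.nonempty_fullyFaithful {A B : C} {f : A ⟶ B}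
    (hf : markingEquivalences W M f) : Nonempty (W.map f).toFunctor.FullyFaithful := by
  obtain ⟨g, h₁, h₂⟩ := hf.comp_map
  exact fullyFaithful_of_markedlyIsomorphic h₁ h₂

variable [CategoryWithWeakEquivalences C] [CategoryWithCofibrations C]
    [CategoryWithFibrations C]

/-! ### Lifting along weak equivalences in the abstract setting -/

namespace IsMarkedStarSetting

variable (h : IsMarkedStarSetting W M)
include h

theorem marked_of_map {A B : C} {f : A ⟶ B} (hf : markingEquivalences W M f) {X Y : W.obj A}
    {m : X ⟶ Y} (hm : (M B).marked ((W.map f).map m)) : (M A).marked m := by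
  obtain ⟨g, h₁, -⟩ := hf.comp_map
  exact marked_of_markedlyIsomorphic h₁ (h.map_marked g hm)

/-- Full faithfulness reduces lifting along an equivalence to lifting on objects: the morphism part
is determined by preimages, and `lift` upgrades it to a morphism of `C`. -/
theorem exists_lift {A E B : C} {f : E ⟶ B} (hf : markingEquivalences W M f) (u : A ⟶ B)
    (o : W.obj A → W.obj E) (ho : ∀ a, (W.map f).obj (o a) = (W.map u).obj a) :
    ∃ l : A ⟶ E, (W.map l).obj = o ∧ l ≫ f = u := by
  obtain ⟨hff⟩ := hf.nonempty_fullyFaithful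
  obtain ⟨k, rfl, hk⟩ := exists_lift_of_fullyFaithful (W.map f) hff (W.map u) o ho
  obtain ⟨l, rfl⟩ := h.lift f u k hff.faithful (h.marked_of_map hf) hk
  exact ⟨l, rfl, h.injective _ _ (by rw [W.map_comp, hk])⟩

/-- This rigidity is what later turns an equivariant choice on objects into an equivariant morphism.
-/
theorem lift_unique {A E B : C} {f : E ⟶ B} (hf : markingEquivalences W M f) {k l : A ⟶ E}
    (ho : (W.map k).obj = (W.map l).obj) (hkl : k ≫ f = l ≫ f) : k = l := by
  obtain ⟨hff⟩ := hf.nonempty_fullyFaithful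
  refine h.injective _ _ (lift_unique_of_faithful (W.map f) hff.faithful _ _ ho ?_)
  rw [← W.map_comp, hkl, W.map_comp]

/-! ### Trivial fibrations and objects with a free action -/

variable {T : C × Grpd.{v, u} ⥤ C} {π : T ⟶ CategoryTheory.Prod.fst C Grpd.{v, u}}
  {p : ∀ (A : C) (𝔾 : Grpd.{v, u}), W.obj (T.obj (A, 𝔾)) → 𝔾} (hT : HasTildeCylinders W M T π p)
include hT

/-- Trivial fibrations are surjective on objects, as they have the right lifting property with
respect to the inclusion of an object into a cylinder. -/
theorem surjective_of_trivialFibration {E B : C} {f : E ⟶ B} (hf : fibrations C f)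
    (hf' : markingEquivalences W M f) : Function.Surjective (W.map f).obj := by
  classical
  intro b
  obtain ⟨g, -, e, he⟩ := hf'.comp_map
  -- The cylinder on the groupoid with two isomorphic objects; `ULift` only adjusts the universe.
  -- The end `false` will carry `f`, and the end `true` leaves room for a modification.
  let S := tildeGrpd.{v} (ULift.{u} Bool)
  obtain ⟨i, hi, hpi, hi'⟩ := hT.exists_incl E (ULift.{u} Bool) ⟨false⟩
  -- The object `(g b, true)`, which lies outside the image of the end `false` because its groupoid
  -- coordinate differs.
  obtain ⟨x, hx, hpx⟩ := hT.exists_obj E S ((W.map g).obj b) (⟨true⟩ : ULift Bool)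
  have hxi : ∀ a, (W.map i).obj a ≠ x := by
    rintro a rfl
    have := (hpi a).symm.trans hpx
    exact absurd (congrArg ULift.down this) (by decide)
  let K := π.app (E, S) ≫ f
  -- `K` sends `x` to `f (g b)`, which the marked isomorphism from `g ≫ f` to the identity connects
  -- to `b`.
  have hw : ∃ w : (W.map K).obj x ⟶ b, (M B).marked w := by
    have h1 : (W.map K).obj x = (W.map g ≫ W.map f).obj b := by
      simp only [K, W.map_comp]
      exact congrArg (W.map f).obj hx
    rw [h1]
    exact ⟨e.hom.app b, he b⟩
  obtain ⟨w, hw⟩ := hw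
  -- The twisting data are the identity everywhere except at `x`, where they are `w`. No
  -- compatibility between objects is needed, since conjugation by any family of unitaries is
  -- functorial.
  obtain ⟨q, hq, hqx, hq'⟩ : ∃ q : ∀ y, Σ c : W.obj B, ((W.map K).obj y ⟶ c),
      (∀ y, (M B).marked (q y).2) ∧ (q x).1 = b ∧ ∀ y, y ≠ x → q y = ⟨_, 𝟙 _⟩ := by
    refine ⟨Function.update (fun y => ⟨_, 𝟙 _⟩) x ⟨b, w⟩, fun y => ?_, ?_, fun y hy => ?_⟩
    · by_cases hy : y = x
      · subst hy
        rw [Function.update_self]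
        exact hw
      · rw [Function.update_of_ne hy]
        exact (M B).id_mem _
    · rw [Function.update_self]
    · rw [Function.update_of_ne hy]
  obtain ⟨H, hH⟩ := h.twist K (fun y => (q y).1) (fun y => (q y).2) hq
  have hiH : i ≫ H = f := by
    have h2 : i ≫ K = f :=
      (Category.assoc _ _ _).symm.trans ((congrArg (· ≫ f) hi).trans (Category.id_comp f))
    refine Eq.trans (h.injective _ _ ?_) h2
    rw [W.map_comp, W.map_comp, hH]
    exact comp_twist _ _ q _ fun a => hq' _ (hxi a)
  -- Injectivity on objects follows from the retraction `π`, which is also the inverse of `i` as an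
  -- equivalence.
  have hcof : trivialCofibrations C i := by
    refine ⟨?_, ?_⟩
    · rw [h.cofibrations_eq]
      have h3 : W.map i ≫ W.map (π.app (E, S)) = 𝟙 _ := by rw [← W.map_comp, hi, W.map_id]
      exact Function.LeftInverse.injective (g := (W.map (π.app (E, S))).obj)
        fun a => Functor.congr_obj (congrArg StarFunctor.toFunctor h3) a
    · rw [h.weakEquivalences_eq]
      refine ⟨π.app (E, S), ?_, hi'⟩
      rw [hi]
      exact markedlyIsomorphic_refl _ _
  rw [h.fibrations_eq] at hf
  have := hf i hcof
  -- The lift `E ♯ S̃ ⟶ E` sends `x` to an object that `f` maps to `H x = b`.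
  have sq : CommSq (𝟙 E) i f H := ⟨by rw [hiH, Category.id_comp]⟩
  refine ⟨(W.map sq.lift).obj x, ?_⟩
  have h4 : (W.map (sq.lift ≫ f)).obj x = (W.map H).obj x := by rw [sq.fac_right]
  rw [W.map_comp] at h4
  refine h4.trans ?_
  rw [hH]
  exact hqx

variable (G : Type u) [Group G] [Limits.HasInitial C]

/-- Objects of `Fun(BG, C)` on whose objects `G` acts freely are projectively cofibrant. -/
theorem isCofibrant_of_free (D : SingleObj G ⥤ C)
    (t : W.obj (D.obj (SingleObj.star G)) → G)
    (ht : ∀ (g : G) x, t ((W.map (D.map (X := SingleObj.star G) (Y := SingleObj.star G) g)).obj x) =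
      g * t x) :
    IsCofibrant D := by
  rw [isCofibrant_iff, cofibration_iff]
  intro E B f hf
  obtain ⟨hf₁, hf₂⟩ := hf
  let s := SingleObj.star G
  have hw : markingEquivalences W M (f.app s) := h.weakEquivalences_eq ▸ hf₂ s
  have hs := h.surjective_of_trivialFibration hT (hf₁ s) hw
  refine ⟨fun {top u} sq => ?_⟩
  -- These preimages are chosen without regard to the action; only their values on the fibre `t = 1`
  -- will be used.
  choose e he using fun y => hs ((W.map (u.app s)).obj y)
  let act (F : SingleObj G ⥤ C) (g : G) : W.obj (F.obj s) → W.obj (F.obj s) :=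
    (W.map (F.map (X := s) (Y := s) g)).obj
  -- In `SingleObj G` the composite `g' ≫ g` is the product `g * g'`, so a functor out of it gives a
  -- left action on objects.
  have act_mul (F : SingleObj G ⥤ C) (g g' : G) (x) : act F (g * g') x = act F g (act F g' x) := by
    have := F.map_comp (X := s) (Y := s) (Z := s) (g' : s ⟶ s) (g : s ⟶ s)
    have h1 : W.map (F.map (X := s) (Y := s) (g * g')) =
        W.map (F.map (X := s) (Y := s) g') ≫ W.map (F.map (X := s) (Y := s) g) := by
      rw [← W.map_comp, ← this]; rfl
    exact Functor.congr_obj (congrArg StarFunctor.toFunctor h1) x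
  have act_one (F : SingleObj G ⥤ C) (x) : act F 1 x = x := by
    have h1 : W.map (F.map (X := s) (Y := s) (1 : G)) = 𝟙 _ := by
      rw [← W.map_id, ← F.map_id]; rfl
    exact Functor.congr_obj (congrArg StarFunctor.toFunctor h1) x
  have act_nat {F F' : SingleObj G ⥤ C} (α : F ⟶ F') (g : G) (x) :
      (W.map (α.app s)).obj (act F g x) = act F' g ((W.map (α.app s)).obj x) := by
    have h1 : W.map (F.map (X := s) (Y := s) g) ≫ W.map (α.app s) =
        W.map (α.app s) ≫ W.map (F'.map (X := s) (Y := s) g) := by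
      rw [← W.map_comp, ← W.map_comp, α.naturality]
    exact Functor.congr_obj (congrArg StarFunctor.toFunctor h1) x
  -- Move `x` to the representative of its orbit with `t = 1`, take the chosen preimage there, and
  -- move back by `t x`.
  let o (x : W.obj (D.obj s)) : W.obj (E.obj s) := act E (t x) (e (act D (t x)⁻¹ x))
  have ho (x) : (W.map (f.app s)).obj (o x) = (W.map (u.app s)).obj x := by
    rw [act_nat, he, ← act_nat, ← act_mul, mul_inv_cancel, act_one]
  obtain ⟨l, hl, hlf⟩ := h.exists_lift hw (u.app s) o ho
  let L : D ⟶ E :=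
    { app := fun _ => l
      naturality := fun _ _ g => by
        refine h.lift_unique hw (funext fun x => ?_) ?_
        · rw [W.map_comp, W.map_comp]
          change (W.map l).obj (act D g x) = act E g ((W.map l).obj x)
          rw [hl]
          -- The representative of the orbit is unchanged, as `(g * t x)⁻¹ * g = (t x)⁻¹`, while the
          -- outer translation picks up the factor `g`. Hence `o` is equivariant.
          have htg : t (act D g x) = g * t x := ht g x
          simp only [o, htg, ← act_mul]
          congr 3
          group
        -- After composition with `f`, both sides of the naturality square for `l` agree, by
        -- naturality of `u` and `f`. Together with agreement on objects this gives equality before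
        -- composing with `f`.
        · have h1 := u.naturality (X := s) (Y := s) g
          have h2 := f.naturality (X := s) (Y := s) g
          refine (Category.assoc _ _ _).trans ?_
          refine (congrArg _ hlf).trans (h1.trans ?_)
          rw [← hlf]
          exact (Category.assoc _ _ _).trans
            ((congrArg (l ≫ ·) h2.symm).trans (Category.assoc _ _ _).symm) }
  exact ⟨⟨{ l := L
            fac_left := Limits.initial.hom_ext _ _
            fac_right := by ext x; exact hlf }⟩⟩

/-- The coordinate in `G̃` is an equivariant map from the objects of `D ♯ G̃` to `G` with its left
translation, so freeness gives cofibrancy. The inclusion at `1 ∈ G` inverts each component of the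
projection up to marked isomorphism. -/
theorem isCofibrantReplacement :
    IsCofibrantReplacement (orbitReplacement G T) (orbitReplacementMap G π) := by
  intro D
  refine ⟨h.isCofibrant_of_free hT G _ (p _ _) fun g x => ?_, ?_⟩
  · exact hT.map_obj _ _ x
  · rw [weakEquivalence_iff]
    intro x
    rw [h.weakEquivalences_eq]
    obtain ⟨i, hi, -, hi'⟩ := hT.exists_incl (D.obj x) G 1
    refine ⟨i, hi', ?_⟩
    change MarkedlyIsomorphic _ (W.map (i ≫ π.app (D.obj x, tildeGrpd.{v} G))) _
    rw [hi]
    exact markedlyIsomorphic_refl _ _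

end IsMarkedStarSetting
end
end Setting
end StarCats

namespace StarCats

open StarCategory

/-! ### The categories of `*`-categories and their marked versions -/

section

variable {C : Type u₁} [Category.{v₁} C]

/-- A category of `*`-categories with additional structure which lifts along faithful morphisms
and is preserved by twisting with unitary morphisms. -/
structure IsStarSetting (U : C ⥤ StarCat.{v, u}) : Prop where
  injective {A B : C} (f g : A ⟶ B) : U.map f = U.map g → f = g
  lift {A E B : C} (f : E ⟶ B) (u : A ⟶ B) (k : U.obj A ⟶ U.obj E)
    (hf : (U.map f).toFunctor.Faithful) (hk : k ≫ U.map f = U.map u) :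
    ∃ l : A ⟶ E, U.map l = k
  twist {A B : C} (f : A ⟶ B) (o : U.obj A → U.obj B) (w : ∀ a, (U.map f).obj a ⟶ o a)
    (hw : ∀ a, IsUnitary (w a)) : ∃ g : A ⟶ B, U.map g = StarFunctor.twist (U.map f) o w hw

/-- Unmarked categories enter the marked formalism through the maximal marking: morphisms of
`*`-categories preserve unitaries, and isomorphisms marked in this sense are exactly the unitary
ones. -/
theorem IsStarSetting.unmarked {U : C ⥤ StarCat.{v, u}} (h : IsStarSetting U)
    [CategoryWithWeakEquivalences C] [CategoryWithCofibrations C] [CategoryWithFibrations C]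
    (hw : weakEquivalences C = unitaryEquivalences U)
    (hc : cofibrations C = injectiveOnObjects U)
    (hf : fibrations C = (trivialCofibrations C).rlp) :
    IsMarkedStarSetting U fun A => unitaryMarking (U.obj A) where
  map_marked f _ _ _ hm := IsUnitary.map (U.map f) hm
  injective := h.injective
  lift f u k hf _ hk := h.lift f u k hf hk
  twist f o w hw := h.twist f o w hw
  weakEquivalences_eq := hw
  cofibrations_eq := hc
  fibrations_eq := hf

/-- A lift preserves marked morphisms because its composite with `f` does and `f` reflects them. A
twist preserves them because a marking is closed under conjugation by marked morphisms. -/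
theorem IsStarSetting.marked {U : C ⥤ StarCat.{v, u}} (h : IsStarSetting U) :
    IsMarkedStarSetting (Marked.forget U) fun A => A.marking where
  map_marked f _ _ _ hm := f.map_marked hm
  injective f g hfg := Marked.hom_ext (h.injective _ _ hfg)
  lift {A E B} f u k hf hf' hk := by
    obtain ⟨l, rfl⟩ := h.lift f.hom u.hom k hf hk
    refine ⟨⟨l, fun {X Y m} hm => hf' ?_⟩, rfl⟩
    have h1 := u.map_marked hm
    change B.marking.marked (((U.map l) ≫ (U.map f.hom)).map m)
    change U.map l ≫ U.map f.hom = U.map u.hom at hk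
    rw [hk]
    exact h1
  twist {A B} f o w hw := by
    obtain ⟨g, hg⟩ := h.twist f.hom o w fun a => B.marking.isUnitary (hw a)
    refine ⟨⟨g, fun {X Y m} hm => ?_⟩, hg⟩
    rw [hg]
    exact B.marking.comp_mem (B.marking.invol_mem (hw _))
      (B.marking.comp_mem (f.map_marked hm) (hw _))
  weakEquivalences_eq := rfl
  cofibrations_eq := rfl
  fibrations_eq := rfl

/-! ### Cylinders, uniformly for marked and unmarked objects -/

/-- A tensor structure over groupoids for marked objects, with the inclusions of the objects of
contractible groupoids. -/
structure HasMarkedCylinders (U : C ⥤ StarCat.{v, u}) (T : C × Grpd.{v, u} ⥤ C)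
    (π : T ⟶ CategoryTheory.Prod.fst C Grpd.{v, u})
    (μ : ∀ (A : Marked U) (𝔾 : Grpd.{v, u}), Marking (U.obj (T.obj (A.obj, 𝔾))))
    (p : ∀ (A : C) (𝔾 : Grpd.{v, u}), U.obj (T.obj (A, 𝔾)) → 𝔾) : Prop where
  map_obj {A B : C} {𝔾 ℍ : Grpd.{v, u}} (f : A ⟶ B) (φ : 𝔾 ⟶ ℍ) (x : U.obj (T.obj (A, 𝔾))) :
    p B ℍ ((U.map (T.map (X := (A, 𝔾)) (Y := (B, ℍ)) (f, φ))).obj x) =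
      (show 𝔾.α ⥤ ℍ.α from φ).obj (p A 𝔾 x)
  exists_obj (A : C) (𝔾 : Grpd.{v, u}) (a : U.obj A) (s : 𝔾) :
    ∃ x, (U.map (π.app (A, 𝔾))).obj x = a ∧ p A 𝔾 x = s
  exists_incl (A : Marked U) (S : Type u) (s : S) :
    ∃ i : A.obj ⟶ T.obj (A.obj, tildeGrpd S), i ≫ π.app (A.obj, tildeGrpd S) = 𝟙 A.obj ∧
      (∀ a, p A.obj (tildeGrpd S) ((U.map i).obj a) = s) ∧
      (∀ {X Y : U.obj A.obj} {m : X ⟶ Y}, A.marking.marked m →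
        (μ A (tildeGrpd S)).marked ((U.map i).map m)) ∧
      MarkedlyIsomorphic (μ A (tildeGrpd S)) (U.map (π.app (A.obj, tildeGrpd S) ≫ i))
        (U.map (𝟙 _))

variable {U : C ⥤ StarCat.{v, u}} {T : C × Grpd.{v, u} ⥤ C}
    {π : T ⟶ CategoryTheory.Prod.fst C Grpd.{v, u}}
    {μ : ∀ (A : Marked U) (𝔾 : Grpd.{v, u}), Marking (U.obj (T.obj (A.obj, 𝔾)))}
    {p : ∀ (A : C) (𝔾 : Grpd.{v, u}), U.obj (T.obj (A, 𝔾)) → 𝔾}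

/-- Mark every object by all of its unitaries and forget the rest: the components of the resulting
isomorphism are marked, hence unitary. -/
theorem HasMarkedCylinders.unmarked (h : HasMarkedCylinders U T π μ p) :
    HasTildeCylinders U (fun A => unitaryMarking (U.obj A)) T π p where
  map_obj := h.map_obj
  exists_obj := h.exists_obj
  exists_incl A S s := by
    obtain ⟨i, hi, hp, -, e, he⟩ := h.exists_incl ⟨A, unitaryMarking _⟩ S s
    exact ⟨i, hi, hp, e, fun a => (μ _ _).isUnitary (he a)⟩

theorem HasMarkedCylinders.marked (h : HasMarkedCylinders U T π μ p)
    (hT : ∀ {P Q : Marked U × Grpd.{v, u}} (F : P ⟶ Q)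
      {X Y : U.obj (T.obj (P.1.obj, P.2))} {f : X ⟶ Y}, (μ P.1 P.2).marked f →
      (μ Q.1 Q.2).marked ((U.map (T.map (X := (P.1.obj, P.2)) (Y := (Q.1.obj, Q.2))
        (F.1.hom, F.2))).map f))
    (hπ : ∀ {P : Marked U × Grpd.{v, u}} {X Y : U.obj (T.obj (P.1.obj, P.2))} {f : X ⟶ Y},
      (μ P.1 P.2).marked f → P.1.marking.marked ((U.map (π.app (P.1.obj, P.2))).map f)) :
    HasTildeCylinders (Marked.forget U) (fun A => A.marking) (Marked.liftTensor T μ hT)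
      (Marked.liftProj (h := hT) π hπ) fun A => p A.obj where
  map_obj f φ x := h.map_obj f.hom φ x
  exists_obj A := h.exists_obj A.obj
  exists_incl A S s := by
    obtain ⟨i, hi, hp, hm, he⟩ := h.exists_incl A S s
    exact ⟨⟨i, hm⟩, Marked.hom_ext hi, hp, he⟩

end

/-! ### `*`-categories -/

theorem isStarSetting_starCat : IsStarSetting (𝟭 StarCat.{v, u}) where
  injective _ _ h := h
  lift _ _ k _ _ := ⟨k, rfl⟩
  twist f o w hw := ⟨StarFunctor.twist f o w hw, rfl⟩

/-- The inclusion of `A` into `A × 𝔾` at an object of `𝔾`. -/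
def starIncl (A : StarCat.{v, u}) (𝔾 : Grpd.{v, u}) (s : 𝔾) : A ⟶ starTensor.obj (A, 𝔾) :=
  ({ obj := fun a => (a, s)
     map := fun f => (f, 𝟙 s)
     map_id := fun _ => rfl
     map_comp := fun f g => Prod.ext rfl (Category.id_comp _).symm
     map_invol := fun f => Prod.ext rfl (by
        change 𝟙 s = Groupoid.inv (𝟙 s)
        rw [Groupoid.inv_eq_inv, IsIso.inv_id]) } : StarFunctor A (A × 𝔾))

theorem hasMarkedCylinders_starTensor :
    HasMarkedCylinders (𝟭 _) starTensor.{v, u} starProj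
      (fun A 𝔾 => A.marking.prod 𝔾) fun _ _ x => x.2 where
  map_obj _ _ _ := rfl
  exists_obj A 𝔾 a s := ⟨(a, s), rfl, rfl⟩
  exists_incl A S s := by
    refine ⟨starIncl A.obj (tildeGrpd S) s, rfl, fun _ => rfl, fun hm => hm, ?_⟩
    -- The component at `(a, t)` is the identity of `a` paired with the only morphism `s → t` of
    -- `S̃`.
    refine markedlyIsomorphic_of_twist_eq _
      (fun x => ((𝟙 x.1, PUnit.unit) : ((x.1, s) : A.obj × tildeGrpd S) ⟶ x))
      (fun x => A.marking.id_mem x.1) ?_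
    refine StarFunctor.ext_functor (CategoryTheory.Functor.hext (fun _ => rfl)
      fun x y f => heq_of_eq (Prod.ext ?_ rfl))
    change invol (𝟙 x.1) ≫ f.1 ≫ 𝟙 y.1 = f.1
    simp

/-! ### `ℂ`-linear `*`-categories -/

/-- Modify the object function of a morphism of `ℂ`-linear `*`-categories along unitary
morphisms. -/
def LinStarFunctor.twist {A : Type u} [Category.{v} A] [Preadditive A] [Linear ℂ A]
    [LinearStarCategory A] {B : Type u₁} [Category.{v₁} B] [Preadditive B] [Linear ℂ B]
    [LinearStarCategory B] (F : LinStarFunctor A B) (o : A → B)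
    (w : ∀ a, F.obj a ⟶ o a) (hw : ∀ a, IsUnitary (w a)) : LinStarFunctor A B where
  toStarFunctor := F.toStarFunctor.twist o w hw
  map_add f g := by
    change invol _ ≫ F.map (f + g) ≫ _ = invol _ ≫ F.map f ≫ _ + invol _ ≫ F.map g ≫ _
    rw [F.map_add, Preadditive.add_comp, Preadditive.comp_add]
    rfl
  map_smul c f := by
    change invol _ ≫ F.map (c • f) ≫ _ = c • (invol _ ≫ F.map f ≫ _)
    rw [F.map_smul, Linear.smul_comp, Linear.comp_smul]
    rfl

theorem isStarSetting_linStarCat : IsStarSetting LinStarCat.forget.{v, u} where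
  injective _ _ h := LinStarFunctor.ext_functor (congrArg StarFunctor.toFunctor h)
  lift {A E B} f u k hf hk := by
    -- The equality `k ≫ f = u` holds only up to `eqToHom` on objects, so `f (k m)` is `u m`
    -- conjugated by such isomorphisms. Conjugation is linear, so linearity of `u` passes to `f (k
    -- m)`, and faithfulness of `f` passes it on to `k`.
    have h {X Y : A} (m : X ⟶ Y) : f.map (k.map m) = _ :=
      Functor.congr_hom (congrArg StarFunctor.toFunctor hk) m
    refine ⟨({ k with
      map_add := fun m n => hf.map_injective (X := k.obj _) (Y := k.obj _) ?_
      map_smul := fun c m => hf.map_injective (X := k.obj _) (Y := k.obj _) ?_ } :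
        LinStarFunctor A E), rfl⟩
    · refine (h (m + n)).trans (Eq.trans ?_ (f.map_add _ _).symm)
      refine Eq.trans ?_ (congrArg₂ (· + ·) (h m) (h n)).symm
      refine (congrArg (fun t => _ ≫ t ≫ _) (u.map_add m n)).trans ?_
      exact (congrArg (_ ≫ ·) (Preadditive.add_comp _ _ _ _ _ _)).trans
        (Preadditive.comp_add _ _ _ _ _ _)
    · refine (h (c • m)).trans (Eq.trans ?_ (f.map_smul _ _).symm)
      refine Eq.trans ?_ (congrArg (c • ·) (h m)).symm
      refine (congrArg (fun t => _ ≫ t ≫ _) (u.map_smul c m)).trans ?_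
      exact (congrArg (_ ≫ ·) (Linear.smul_comp _ _ _ _ _ _)).trans
        (Linear.comp_smul _ _ _ _ _ _)
  twist f o w hw := ⟨LinStarFunctor.twist f o w hw, rfl⟩

namespace LTens

section

variable (A : Type u) [Category.{v} A] [Preadditive A] [Linear ℂ A] [LinearStarCategory A]

/-- The inclusion of `A` into `A ⊗ 𝔾` at an object of `𝔾`. -/
noncomputable def incl (𝔾 : Grpd.{v, u}) (s : 𝔾) : LinStarFunctor A (LTens A 𝔾) where
  obj a := ⟨a, s⟩
  map f := single (𝟙 s) f
  map_id a := rfl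
  map_comp f g := by rw [single_comp, Category.comp_id]
  map_invol f := by rw [invol_single]; simp
  map_add f g := single_add _ _ _
  map_smul c f := (smul_single _ _ _).symm

variable {A} {S : Type u}

/-- The unitary morphisms which identify the objects of `A ⊗ S̃` over an object of `A`. -/
noncomputable def tildeHom (s : tildeGrpd.{v} S) (x : LTens A (tildeGrpd.{v} S)) :
    (⟨x.fst, s⟩ : LTens A (tildeGrpd.{v} S)) ⟶ x :=
  single (show s ⟶ x.snd from PUnit.unit) (𝟙 x.fst)

theorem isUnitary_tildeHom (s : tildeGrpd.{v} S) (x : LTens A (tildeGrpd.{v} S)) : IsUnitary (tildeHom s x) :=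
  isUnitary_single _ ((unitaryMarking A).id_mem _)

/-- There is only one morphism between two objects of `S̃`, so the conjugated groupoid component
must be `φ`, and on the `A`-component the conjugation is by identities. This is the naturality of
`tildeHom` on generators. -/
theorem conj_tildeHom (s : tildeGrpd.{v} S) {x y : LTens A (tildeGrpd.{v} S)} (φ : x.snd ⟶ y.snd)
    (f : x.fst ⟶ y.fst) :
    invol (tildeHom s x) ≫ (single (𝟙 s) f :
      (⟨x.fst, s⟩ : LTens A (tildeGrpd.{v} S)) ⟶ ⟨y.fst, s⟩) ≫ tildeHom s y = single φ f := by
  unfold tildeHom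
  rw [single_comp, invol_single, single_comp]
  congr 1
  simp

end

theorem incl_proj (A : LinStarCat.{v, u}) (𝔾 : Grpd.{v, u}) (s : 𝔾) :
    (show A ⟶ linTensor.obj (A, 𝔾) from incl A 𝔾 s) ≫ linProj.app (A, 𝔾) = 𝟙 A :=
  LinStarFunctor.ext_functor (CategoryTheory.Functor.hext (fun _ => rfl)
    fun a b f => heq_of_eq
      (projHom_single (X := (⟨a, s⟩ : LTens A 𝔾)) (Y := ⟨b, s⟩) (𝟙 s) f))

end LTens

theorem hasMarkedCylinders_linTensor :
    HasMarkedCylinders LinStarCat.forget linTensor.{v, u} linProj linMarking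
      fun _ _ x => LTens.snd x where
  map_obj _ _ _ := rfl
  exists_obj A 𝔾 a s := ⟨(⟨a, s⟩ : LTens A 𝔾), rfl, rfl⟩
  exists_incl A S s := by
    refine ⟨LTens.incl A.obj (tildeGrpd S) s, LTens.incl_proj _ _ _, fun _ => rfl,
      fun hm => ⟨_, _, hm, rfl⟩, ?_⟩
    refine markedlyIsomorphic_of_twist_eq _ (LTens.tildeHom (A := A.obj) s)
      (fun x => ⟨_, _, A.marking.id_mem _, rfl⟩) ?_
    -- The twist of `proj` followed by `incl` is compared with the identity as a linear functor, so
    -- that only the generators `(φ, f)` have to be checked.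
    refine congrArg LinStarFunctor.toStarFunctor (LTens.functor_ext
      (F := LinStarFunctor.twist ((LTens.proj A.obj (tildeGrpd.{v} S)).comp
        (LTens.incl A.obj (tildeGrpd.{v} S) s)) (fun x => x) _ (LTens.isUnitary_tildeHom s))
      (F' := 𝟙 (linTensor.obj (A.obj, tildeGrpd.{v} S))) (fun _ => rfl)
      fun {X Y} φ f => heq_of_eq ?_)
    refine Eq.trans ?_ (LTens.conj_tildeHom (A := A.obj) s φ f)
    exact congrArg (fun t => invol (LTens.tildeHom s X) ≫
      (LTens.incl A.obj (tildeGrpd.{v} S) s).map t ≫ LTens.tildeHom s Y)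
      (LTens.projHom_single φ f)

/-! ### `C^*`-categories -/

/-- `C^*`-categories form a full subcategory of the linear ones, and neither lifting nor twisting
alters source or target, so no norm condition arises. -/
theorem isStarSetting_cstarCat : IsStarSetting CStarCat.forget.{v, u} where
  injective _ _ h := ObjectProperty.hom_ext _ (isStarSetting_linStarCat.injective _ _ h)
  lift f u k hf hk := by
    obtain ⟨l, hl⟩ := isStarSetting_linStarCat.lift f.hom u.hom k hf hk
    exact ⟨ObjectProperty.homMk l, hl⟩
  twist f o w hw := by
    obtain ⟨l, hl⟩ := isStarSetting_linStarCat.twist f.hom o w hw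
    exact ⟨ObjectProperty.homMk l, hl⟩

section

variable {A : Type u} [Category.{v} A] [Preadditive A] [Linear ℂ A] [LinearStarCategory A]
  [IsCStar A] {S : Type u}

/-- The unitary morphisms which identify the objects of the completion of `A ⊗ S̃` over an object
of `A`. -/
noncomputable def cstarTildeHom (s : tildeGrpd.{v} S) (x : Compl (LTens A (tildeGrpd.{v} S))) :
    (⟨⟨x.as.fst, s⟩⟩ : Compl (LTens A (tildeGrpd.{v} S))) ⟶ x :=
  (Compl.ι _).map (LTens.tildeHom s x.as)

theorem isUnitary_cstarTildeHom (s : tildeGrpd.{v} S) (x : Compl (LTens A (tildeGrpd.{v} S))) :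
    IsUnitary (cstarTildeHom s x) :=
  (LTens.isUnitary_tildeHom s x.as).map (Compl.ι _).toStarFunctor

theorem conj_cstarTildeHom (s : tildeGrpd.{v} S) {x y : Compl (LTens A (tildeGrpd.{v} S))}
    (φ : x.as.snd ⟶ y.as.snd) (f : x.as.fst ⟶ y.as.fst) :
    invol (cstarTildeHom s x) ≫
      ((LTens.incl A (tildeGrpd.{v} S) s).comp (Compl.ι _)).map f ≫ cstarTildeHom s y =
      Compl.of (LTens.single φ f) := by
  have h := congrArg (Compl.ι _).map (LTens.conj_tildeHom s φ f)
  rw [(Compl.ι _).map_comp, (Compl.ι _).map_comp, (Compl.ι _).map_invol] at h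
  exact h

end

theorem hasMarkedCylinders_cstarTensor :
    HasMarkedCylinders CStarCat.forget cstarTensor.{v, u} cstarProj cstarMarking
      fun _ _ x => LTens.snd (Compl.as x) where
  map_obj _ _ _ := rfl
  exists_obj A 𝔾 a s := ⟨(⟨⟨a, s⟩⟩ : Compl (LTens A.obj 𝔾)), rfl, rfl⟩
  exists_incl A S s := by
    refine ⟨ObjectProperty.homMk
      ((LTens.incl A.obj.obj (tildeGrpd S) s).comp (Compl.ι _)), ?_, fun _ => rfl,
      fun hm => ⟨_, ⟨_, _, hm, rfl⟩, rfl⟩, ?_⟩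
    · refine ObjectProperty.hom_ext _ (LinStarFunctor.ext_functor
        (CategoryTheory.Functor.hext (fun _ => rfl) fun a b f => heq_of_eq ?_))
      exact cstarProjFun_of (A := A.obj.obj) (𝔾 := tildeGrpd.{v} S) (X := ⟨⟨a, s⟩⟩)
        (Y := ⟨⟨b, s⟩⟩) (𝟙 (show tildeGrpd.{v} S from s)) f
    · refine markedlyIsomorphic_of_twist_eq _ (cstarTildeHom (A := A.obj.obj) s)
        (fun x => ⟨_, ⟨_, _, A.marking.id_mem _, rfl⟩, rfl⟩) ?_
      -- Morphisms from the completion to a `C^*`-category are continuous, so the span of the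
      -- generators, which is dense, again suffices.
      refine congrArg LinStarFunctor.toStarFunctor (Compl.tens_functor_ext
        (F := LinStarFunctor.twist ((cstarProjFun A.obj.obj (tildeGrpd.{v} S)).comp
          ((LTens.incl A.obj.obj (tildeGrpd.{v} S) s).comp (Compl.ι _)))
          (fun x => x) _ (isUnitary_cstarTildeHom s))
        (F' := 𝟙 (cstarTensor.obj (A.obj, tildeGrpd.{v} S)).obj) (fun _ => rfl)
        fun {X Y} φ f => heq_of_eq ?_)
      refine Eq.trans ?_ (conj_cstarTildeHom (A := A.obj.obj) s φ f)
      exact congrArg (fun t => invol (cstarTildeHom s X) ≫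
        ((LTens.incl A.obj.obj (tildeGrpd.{v} S) s).comp (Compl.ι _)).map t ≫ cstarTildeHom s Y)
        (cstarProjFun_of φ f)

end StarCats

/-! ### The six cases -/

theorem mainTheorem11 (G : Type u) [Group G] :
    StarCats.IsCofibrantReplacement
      (StarCats.orbitReplacement G StarCats.starTensor.{v, u})
      (StarCats.orbitReplacementMap G StarCats.starProj.{v, u}) ∧
    StarCats.IsCofibrantReplacement
      (StarCats.orbitReplacement G StarCats.linTensor.{v, u})
      (StarCats.orbitReplacementMap G StarCats.linProj.{v, u}) ∧
    StarCats.IsCofibrantReplacement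
      (StarCats.orbitReplacement G StarCats.cstarTensor.{v, u})
      (StarCats.orbitReplacementMap G StarCats.cstarProj.{v, u}) ∧
    StarCats.IsCofibrantReplacement
      (StarCats.orbitReplacement G StarCats.markedStarTensor.{v, u})
      (StarCats.orbitReplacementMap G StarCats.markedStarProj.{v, u}) ∧
    StarCats.IsCofibrantReplacement
      (StarCats.orbitReplacement G StarCats.markedLinTensor.{v, u})
      (StarCats.orbitReplacementMap G StarCats.markedLinProj.{v, u}) ∧
    StarCats.IsCofibrantReplacement
      (StarCats.orbitReplacement G StarCats.markedCStarTensor.{v, u})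
      (StarCats.orbitReplacementMap G StarCats.markedCStarProj.{v, u}) := by
  refine ⟨?_, ?_, ?_, ?_, ?_, ?_⟩
  · exact (StarCats.isStarSetting_starCat.unmarked rfl rfl rfl).isCofibrantReplacement
      StarCats.hasMarkedCylinders_starTensor.unmarked G
  · exact (StarCats.isStarSetting_linStarCat.unmarked rfl rfl rfl).isCofibrantReplacement
      StarCats.hasMarkedCylinders_linTensor.unmarked G
  · exact (StarCats.isStarSetting_cstarCat.unmarked rfl rfl rfl).isCofibrantReplacement
      StarCats.hasMarkedCylinders_cstarTensor.unmarked G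
  · exact StarCats.isStarSetting_starCat.marked.isCofibrantReplacement
      (StarCats.hasMarkedCylinders_starTensor.marked _ _) G
  · exact StarCats.isStarSetting_linStarCat.marked.isCofibrantReplacement
      -- That the projection preserves marked morphisms is part of the marked projection itself and
      -- is read off from it.
      (StarCats.hasMarkedCylinders_linTensor.marked _ fun {P _ _ _} hf =>
        (StarCats.markedLinProj.app P).map_marked hf) G
  · exact StarCats.isStarSetting_cstarCat.marked.isCofibrantReplacement
      (StarCats.hasMarkedCylinders_cstarTensor.marked _ fun {P _ _ _} hf =>
        (StarCats.markedCStarProj.app P).map_marked hf) G
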